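/- Running times are counted in steps of a random access machine: a finite deterministic program over natural-number variables and arrays, whose unit-cost operations are loading constants, reading and writing variables and array cells, addition, truncated subtraction, and conditional branches and loops testing whether a number is nonzero. All logarithms are to base $2$. Theorem 3.3. There are a single random access machine program and an absolute constant $C$ such that the following holds for all $n\ge 1$ and $t,b\ge 0$. Let $G\le \mathrm{S}_n$ be a transitive permutation group of degree $n$, let $x_1,\dots,x_t$ be permutations that generate $G$, and let $B=(\beta_1,\dots,\beta_b)$ be a sequence of points which is a base for $G$, that is, whose pointwise stabiliser in $G$ is trivial. On input $n$, $t$, $b$, $(x_1,\dots,x_t)$ (each $x_i$ given by its list of images) and $(\beta_1,\dots,\beta_b)$, the program halts and outputs a list of permutations that generates the normaliser $N_{\mathrm{S}_n}(G)$, after at most $$2^{C\max(1,\;t\,b\log n)}$$ steps. In particular, for $n\ge 2$ (where transitivity forces $t,b\ge 1$, so that $tb\log n\ge 1$), generators of $N_{\mathrm{S}_n}(G)$ are computed in time $2^{O(tb\log n)}$. -/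

import Mathlib

/-!
# A random access machine with a step count

Programs are finite pieces of syntax over natural-number variables and arrays (the memory), both
named by natural numbers; a program can mention only finitely many of them.  Every array cell is
accessible by its address.  The arithmetic is addition and truncated subtraction (there is no
multiplication), so that in `T` steps the machine only produces numbers with at most `O(T)` bits
more than those of the input, and step counts agree with Turing machine time up to a polynomial.
-/

namespace RAM

/-- The contents of the memory: variables `x` and array cells `a[i]`. -/
structure State where
  var : ℕ → ℕ
  arr : ℕ → ℕ → ℕ

/-- Expressions: constants, variables, array reads, sums and truncated differences. -/
inductive Expr where
  | const (c : ℕ) : Expr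
  | var (x : ℕ) : Expr
  | read (a : ℕ) (i : Expr) : Expr
  | add (e f : Expr) : Expr
  | sub (e f : Expr) : Expr

/-- The value of an expression. -/
def Expr.eval (s : State) : Expr → ℕ
  | .const c => c
  | .var x => s.var x
  | .read a i => s.arr a (i.eval s)
  | .add e f => e.eval s + f.eval s
  | .sub e f => e.eval s - f.eval s

/-- The number of steps for evaluating an expression: one for each operation in it. -/
def Expr.cost : Expr → ℕ
  | .const _ => 1
  | .var _ => 1
  | .read _ i => i.cost + 1
  | .add e f => e.cost + f.cost + 1
  | .sub e f => e.cost + f.cost + 1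

/-- Programs.  A test `c` succeeds when the value of `c` is nonzero. -/
inductive Prog where
  | skip : Prog
  | assign (x : ℕ) (e : Expr) : Prog
  | store (a : ℕ) (i e : Expr) : Prog
  | seq (P Q : Prog) : Prog
  | cond (c : Expr) (P Q : Prog) : Prog
  | loop (c : Expr) (P : Prog) : Prog

/-- The state after the assignment `x := v`. -/
def State.setVar (s : State) (x v : ℕ) : State :=
  { s with var := Function.update s.var x v }

/-- The state after the assignment `a[i] := v`. -/
def State.setArr (s : State) (a i v : ℕ) : State :=
  { s with arr := Function.update s.arr a (Function.update (s.arr a) i v) }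

/-- `Exec P s s' k`: started in the state `s`, the program `P` halts in the state `s'` after
exactly `k` steps. -/
inductive Exec : Prog → State → State → ℕ → Prop where
  | skip (s : State) : Exec .skip s s 1
  | assign (s : State) (x : ℕ) (e : Expr) :
      Exec (.assign x e) s (s.setVar x (e.eval s)) (e.cost + 1)
  | store (s : State) (a : ℕ) (i e : Expr) :
      Exec (.store a i e) s (s.setArr a (i.eval s) (e.eval s)) (i.cost + e.cost + 1)
  | seq {P Q : Prog} {s s' s'' : State} {k l : ℕ} :
      Exec P s s' k → Exec Q s' s'' l → Exec (.seq P Q) s s'' (k + l)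
  | cond_true {c : Expr} {P Q : Prog} {s s' : State} {k : ℕ} :
      c.eval s ≠ 0 → Exec P s s' k → Exec (.cond c P Q) s s' (c.cost + 1 + k)
  | cond_false {c : Expr} {P Q : Prog} {s s' : State} {k : ℕ} :
      c.eval s = 0 → Exec Q s s' k → Exec (.cond c P Q) s s' (c.cost + 1 + k)
  | loop_true {c : Expr} {P : Prog} {s s' s'' : State} {k l : ℕ} :
      c.eval s ≠ 0 → Exec P s s' k → Exec (.loop c P) s' s'' l →
      Exec (.loop c P) s s'' (c.cost + 1 + k + l)
  | loop_false {c : Expr} {P : Prog} {s : State} :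
      c.eval s = 0 → Exec (.loop c P) s s (c.cost + 1)

/-- The machine is deterministic: final state and step count are determined by the program and
the initial state. -/
theorem Exec.deterministic {P : Prog} {s s₁ s₂ : State} {k₁ k₂ : ℕ}
    (h₁ : Exec P s s₁ k₁) (h₂ : Exec P s s₂ k₂) : s₁ = s₂ ∧ k₁ = k₂ := by
  induction h₁ generalizing s₂ k₂ with
  | skip s => cases h₂; exact ⟨rfl, rfl⟩
  | assign s x e => cases h₂; exact ⟨rfl, rfl⟩
  | store s a i e => cases h₂; exact ⟨rfl, rfl⟩
  | seq _ _ ih₁ ih₂ =>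
    cases h₂ with
    | seq h h' =>
      obtain ⟨rfl, rfl⟩ := ih₁ h
      obtain ⟨rfl, rfl⟩ := ih₂ h'
      exact ⟨rfl, rfl⟩
  | cond_true hc _ ih =>
    cases h₂ with
    | cond_true _ h => obtain ⟨rfl, rfl⟩ := ih h; exact ⟨rfl, rfl⟩
    | cond_false hc' _ => exact absurd hc' hc
  | cond_false hc _ ih =>
    cases h₂ with
    | cond_true hc' _ => exact absurd hc hc'
    | cond_false _ h => obtain ⟨rfl, rfl⟩ := ih h; exact ⟨rfl, rfl⟩
  | loop_true hc _ _ ih₁ ih₂ =>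
    cases h₂ with
    | loop_true _ h h' =>
      obtain ⟨rfl, rfl⟩ := ih₁ h
      obtain ⟨rfl, rfl⟩ := ih₂ h'
      exact ⟨rfl, rfl⟩
    | loop_false hc' => exact absurd hc' hc
  | loop_false hc =>
    cases h₂ with
    | loop_true hc' _ _ => exact absurd hc hc'
    | loop_false _ => exact ⟨rfl, rfl⟩

/-- The initial state on input a tuple `x` of `t` permutations of `{0, …, n - 1}` and a tuple `β`
of `b` points.  Variables `0`, `1`, `2` hold `n`, `t`, `b`; array `0` holds the image lists of the
permutations, one after the other, i.e. `x i j` at address `i * n + j`; array `1` holds `β`.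
The rest of the memory is `0`. -/
def initial {n t b : ℕ} (x : Fin t → Equiv.Perm (Fin n)) (β : Fin b → Fin n) : State where
  var := fun v => if v = 0 then n else if v = 1 then t else if v = 2 then b else 0
  arr := fun a k =>
    if a = 0 then
      if h : k < t * n then
        (x (finProdFinEquiv.symm ⟨k, h⟩).1 (finProdFinEquiv.symm ⟨k, h⟩).2 : ℕ)
      else 0
    else if a = 1 then
      if h : k < b then (β ⟨k, h⟩ : ℕ) else 0
    else 0

theorem initial_perm {n t b : ℕ} (x : Fin t → Equiv.Perm (Fin n)) (β : Fin b → Fin n)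
    (i : Fin t) (j : Fin n) : (initial x β).arr 0 (i * n + j) = x i j := by
  have key : finProdFinEquiv (i, j) = ⟨j + n * i, (finProdFinEquiv (i, j)).isLt⟩ := rfl
  have hlt : (i : ℕ) * n + j < t * n := by
    have := (finProdFinEquiv (i, j)).isLt
    rw [key] at this
    simpa [mul_comm, add_comm] using this
  have heq : (⟨(i : ℕ) * n + j, hlt⟩ : Fin (t * n)) = finProdFinEquiv (i, j) := by
    rw [key]; ext; simp [mul_comm, add_comm]
  simp only [initial, if_true, dif_pos hlt, heq, Equiv.symm_apply_apply]

/-- In the state `s`, the machine holds a list of generators of the subgroup `N` of the symmetric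
group on `{0, …, n - 1}`: variable `3` is the number of generators, and array `2` holds their image
lists, one after the other. -/
def HoldsGenerators {n : ℕ} (s : State) (N : Subgroup (Equiv.Perm (Fin n))) : Prop :=
  ∃ y : Fin (s.var 3) → Equiv.Perm (Fin n),
    (∀ (i : Fin (s.var 3)) (j : Fin n), s.arr 2 (i * n + j) = y i j) ∧
    Subgroup.closure (Set.range y) = N

end RAM

/-- The sequence `β` of points is a base of the permutation group `G`: the pointwise stabiliser of
`β` in `G` is trivial. -/
def IsBase {n b : ℕ} (G : Subgroup (Equiv.Perm (Fin n))) (β : Fin b → Fin n) : Prop :=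
  ∀ g ∈ G, (∀ j, g (β j) = β j) → g = 1

/-!
# Computing the normaliser of a transitive group

Let `G` be a transitive group of degree `n`, generated by `x = (x 0, …, x (t - 1))`, with a base
of `b` points.  An element of `G` is determined by the images of the base points, so there are at
most `n ^ (t * b)` tuples `y` of `t` elements of `G`.  A permutation `σ` normalises `G` if and
only if it conjugates `x` to such a tuple, i.e. `σ (x i a) = y i (σ a)` for all `i` and `a`
(`RAM.exists_conjugates_iff`).  By these equations and transitivity, `σ` is determined by `y` and
the value `σ 0`.  The program therefore lists all tuples `y` (`RAM.closeList`), tries for each of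
them all values `c` of `σ 0`, propagates `c` along the generators (`RAM.build`), and outputs the
result if it is a permutation that satisfies the equations (`RAM.test`).  The output is the set of
all elements of the normaliser.

The list of tuples starts with the tuple of identities and is closed under multiplying one entry
from the left by one generator; since `G` is finite, this yields all tuples of elements of `G`
(`RAM.mem_of_closed_under_moves`).  The base points are never read; they only bound the running
time.

Running times are handled by a syntactic exponent: if every loop of a program `P` makes at most
`X` passes whenever it is entered, then `P` takes at most `(X + 2) ^ P.exponent` steps, and this
is built into the correctness assertions `RAM.Runs`.  For the program here, `X = n ^ (2 * (t *
b))` will do.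

Besides the input and the output (variables `0` to `3`, arrays `0` to `2`), the program uses the
variables `4` (the length `t * n` of the image list of a tuple), `5` (the number of tuples), `6`
(the index of a tuple), `7` and `8` (indices of entries and generators), `9`, `12`, `14`, `15`,
`18` (loop counters), `10`, `11`, `16` (results of tests), `13` (the value of `σ 0`) and `17` (the
end of the output), and the arrays `3` (multiples of `n`), `4` (tuples), `5` (addresses of tuples)
and `6` (the partial permutation under construction).
-/

namespace RAM

/-! ### Time-bounded correctness of programs -/

/-- An exponent bounding the running time: if every loop of `P` is passed through at most `X` times
whenever it is entered, then `P` takes at most `(X + 2) ^ P.exponent` steps. -/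
def Prog.exponent : Prog → ℕ
  | .skip => 1
  | .assign _ e => e.cost + 1
  | .store _ i e => i.cost + e.cost + 1
  | .seq P Q => P.exponent + Q.exponent
  | .cond c P Q => c.cost + 1 + (P.exponent + Q.exponent)
  | .loop c P => c.cost + 1 + P.exponent + 1

/-- Whether the variable `v` occurs as the target of an assignment. -/
def Prog.writesVar : Prog → ℕ → Bool
  | .skip, _ => false
  | .assign x _, v => v == x
  | .store _ _ _, _ => false
  | .seq P Q, v => P.writesVar v || Q.writesVar v
  | .cond _ P Q, v => P.writesVar v || Q.writesVar v
  | .loop _ P, v => P.writesVar v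

/-- Whether the array `a` occurs as the target of a store. -/
def Prog.writesArr : Prog → ℕ → Bool
  | .skip, _ => false
  | .assign _ _, _ => false
  | .store b _ _, a => a == b
  | .seq P Q, a => P.writesArr a || Q.writesArr a
  | .cond _ P Q, a => P.writesArr a || Q.writesArr a
  | .loop _ P, a => P.writesArr a

/-- The states `s` and `s'` agree on everything that `P` does not mention as a target. -/
structure Agree (P : Prog) (s s' : State) : Prop where
  var : ∀ v, P.writesVar v = false → s'.var v = s.var v
  arr : ∀ a, P.writesArr a = false → s'.arr a = s.arr a

theorem Agree.refl (P : Prog) (s : State) : Agree P s s := ⟨fun _ _ => rfl, fun _ _ => rfl⟩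

theorem Agree.trans {P : Prog} {s s' s'' : State} (h : Agree P s s') (h' : Agree P s' s'') :
    Agree P s s'' :=
  ⟨fun v hv => (h'.var v hv).trans (h.var v hv), fun a ha => (h'.arr a ha).trans (h.arr a ha)⟩

theorem Agree.mono {P Q : Prog} {s s' : State} (h : Agree P s s')
    (hv : ∀ v, Q.writesVar v = false → P.writesVar v = false)
    (ha : ∀ a, Q.writesArr a = false → P.writesArr a = false) : Agree Q s s' :=
  ⟨fun v h' => h.var v (hv v h'), fun a h' => h.arr a (ha a h')⟩

@[simp] theorem State.setVar_arr (s : State) (x v : ℕ) : (s.setVar x v).arr = s.arr := rfl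

@[simp] theorem State.setArr_var (s : State) (a i v : ℕ) : (s.setArr a i v).var = s.var := rfl

theorem State.setVar_var (s : State) (x v y : ℕ) :
    (s.setVar x v).var y = if y = x then v else s.var y := by
  simp [State.setVar, Function.update_apply]

theorem State.setArr_arr (s : State) (a i v j : ℕ) :
    (s.setArr a i v).arr a j = if j = i then v else s.arr a j := by
  simp [State.setArr, Function.update_apply]

theorem State.setArr_arr_of_ne (s : State) {a b : ℕ} (i v : ℕ) (h : b ≠ a) :
    (s.setArr a i v).arr b = s.arr b := by
  simp [State.setArr, Function.update_of_ne h]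

/-- Frame rule: a program changes nothing but the targets of its assignments and stores. -/
theorem Exec.agree {P : Prog} {s s' : State} {k : ℕ} (h : Exec P s s' k) : Agree P s s' := by
  induction h with
  | skip s => exact Agree.refl _ _
  | assign s x e =>
    refine ⟨fun v hv => ?_, fun _ _ => rfl⟩
    simp only [Prog.writesVar, beq_eq_false_iff_ne] at hv
    simp [State.setVar_var, hv]
  | store s a i e =>
    refine ⟨fun _ _ => rfl, fun b hb => ?_⟩
    simp only [Prog.writesArr, beq_eq_false_iff_ne] at hb
    exact State.setArr_arr_of_ne _ _ _ hb
  | seq _ _ ih₁ ih₂ =>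
    refine (ih₁.mono ?_ ?_).trans (ih₂.mono ?_ ?_) <;>
      simp +contextual [Prog.writesVar, Prog.writesArr]
  | cond_true _ _ ih | cond_false _ _ ih =>
    refine ih.mono ?_ ?_ <;> simp +contextual [Prog.writesVar, Prog.writesArr]
  | loop_true _ _ _ ih₁ ih₂ =>
    refine (ih₁.mono ?_ ?_).trans ih₂ <;> simp [Prog.writesVar, Prog.writesArr]
  | loop_false _ => exact Agree.refl _ _

/-- Started in `s`, the program `P` halts in a state satisfying `Q`, within the time
`(X + 2) ^ P.exponent`. -/
def Runs (X : ℕ) (P : Prog) (s : State) (Q : State → Prop) : Prop :=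
  ∃ s' k, Exec P s s' k ∧ k ≤ (X + 2) ^ P.exponent ∧ Q s'

variable {X : ℕ}

theorem Prog.one_le_exponent (P : Prog) : 1 ≤ P.exponent := by
  induction P <;> simp only [Prog.exponent] <;> omega

theorem le_base_pow (X k : ℕ) : k ≤ (X + 2) ^ k :=
  (Nat.lt_pow_self (by omega)).le

theorem two_le_base_pow (X : ℕ) {k : ℕ} (hk : 1 ≤ k) : 2 ≤ (X + 2) ^ k :=
  le_trans (by omega) (Nat.le_self_pow (by omega) (X + 2))

/-- Sequential composition adds exponents: each of the two powers is at least `2`, so that their sum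
is at most their product. -/
theorem add_le_base_pow {k l p q : ℕ} (hk : k ≤ (X + 2) ^ p) (hl : l ≤ (X + 2) ^ q)
    (hp : 1 ≤ p) (hq : 1 ≤ q) : k + l ≤ (X + 2) ^ (p + q) := by
  have h₁ := two_le_base_pow X hp
  have h₂ := two_le_base_pow X hq
  rw [pow_add]
  nlinarith

theorem Runs.mono {P : Prog} {s : State} {Q R : State → Prop} (h : Runs X P s Q)
    (hQ : ∀ s', Agree P s s' → Q s' → R s') : Runs X P s R := by
  obtain ⟨s', k, he, hk, hq⟩ := h
  exact ⟨s', k, he, hk, hQ s' he.agree hq⟩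

theorem Runs.skip {s : State} {Q : State → Prop} (h : Q s) : Runs X .skip s Q :=
  ⟨s, 1, .skip s, by simp [Prog.exponent], h⟩

theorem Runs.assign {s : State} {x : ℕ} {e : Expr} {Q : State → Prop}
    (h : Q (s.setVar x (e.eval s))) : Runs X (.assign x e) s Q :=
  ⟨_, _, .assign s x e, le_base_pow _ _, h⟩

theorem Runs.store {s : State} {a : ℕ} {i e : Expr} {Q : State → Prop}
    (h : Q (s.setArr a (i.eval s) (e.eval s))) : Runs X (.store a i e) s Q :=
  ⟨_, _, .store s a i e, le_base_pow _ _, h⟩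

theorem Runs.seq {P P' : Prog} {s : State} {Q R : State → Prop} (h : Runs X P s Q)
    (h' : ∀ s', Agree P s s' → Q s' → Runs X P' s' R) : Runs X (.seq P P') s R := by
  obtain ⟨s', k, he, hk, hq⟩ := h
  obtain ⟨s'', l, he', hl, hr⟩ := h' s' he.agree hq
  exact ⟨s'', k + l, .seq he he',
    add_le_base_pow hk hl P.one_le_exponent P'.one_le_exponent, hr⟩

theorem Runs.cond {c : Expr} {P P' : Prog} {s : State} {Q : State → Prop}
    (h : c.eval s ≠ 0 → Runs X P s Q) (h' : c.eval s = 0 → Runs X P' s Q) :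
    Runs X (.cond c P P') s Q := by
  have hp := P.one_le_exponent
  have hp' := P'.one_le_exponent
  by_cases hc : c.eval s = 0
  · obtain ⟨s', k, he, hk, hq⟩ := h' hc
    exact ⟨s', _, .cond_false hc he, add_le_base_pow (le_base_pow _ _)
      (hk.trans (Nat.pow_le_pow_right (by omega) (by omega))) (by omega) (by omega), hq⟩
  · obtain ⟨s', k, he, hk, hq⟩ := h hc
    exact ⟨s', _, .cond_true hc he, add_le_base_pow (le_base_pow _ _)
      (hk.trans (Nat.pow_le_pow_right (by omega) (by omega))) (by omega) (by omega), hq⟩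

/-- A loop that makes at most `X` passes, with an invariant `I i` that holds before pass `i`. -/
theorem Runs.loop {c : Expr} {P : Prog} {s : State} (I : ℕ → State → Prop) (h₀ : I 0 s)
    (hX : ∀ i s', I i s' → c.eval s' ≠ 0 → i < X)
    (hI : ∀ i s', Agree (.loop c P) s s' → I i s' → c.eval s' ≠ 0 → Runs X P s' (I (i + 1))) :
    Runs X (.loop c P) s (fun s' => c.eval s' = 0 ∧ ∃ i, I i s') := by
  set T := (X + 2) ^ P.exponent with hT
  have key : ∀ d i s', i ≤ X → X - i ≤ d → Agree (.loop c P) s s' → I i s' →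
      ∃ s'' k, Exec (.loop c P) s' s'' k ∧ k ≤ d * (c.cost + 1 + T) + (c.cost + 1) ∧
        (c.eval s'' = 0 ∧ ∃ i, I i s'') := by
    intro d
    induction d with
    | zero =>
      intro i s' _ hd _ hi
      by_cases hc : c.eval s' = 0
      · exact ⟨s', _, .loop_false hc, by omega, hc, i, hi⟩
      · have := hX i s' hi hc
        omega
    | succ d ih =>
      intro i s' _ hd ha hi
      by_cases hc : c.eval s' = 0
      · exact ⟨s', _, .loop_false hc, by omega, hc, i, hi⟩
      · have := hX i s' hi hc
        obtain ⟨s₁, k, he, hk, h₁⟩ := hI i s' ha hi hc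
        obtain ⟨s₂, l, he', hl, h₂⟩ := ih (i + 1) s₁ (by omega) (by omega)
          (ha.trans ⟨he.agree.var, he.agree.arr⟩) h₁
        refine ⟨s₂, _, .loop_true hc he he', ?_, h₂⟩
        rw [← hT] at hk
        rw [Nat.succ_mul]
        omega
  obtain ⟨s', k, he, hk, hq⟩ := key X 0 s (by omega) (by omega) (Agree.refl _ _) h₀
  refine ⟨s', k, he, hk.trans ?_, hq⟩
  have h1 : c.cost + 1 + T ≤ (X + 2) ^ (c.cost + 1 + P.exponent) :=
    add_le_base_pow (le_base_pow _ _) le_rfl (by omega) P.one_le_exponent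
  simp only [Prog.exponent]
  rw [pow_succ]
  nlinarith

/-- The loop `for v = 0, …, e - 1 do P`. -/
def forLoop (v : ℕ) (e : Expr) (P : Prog) : Prog :=
  .seq (.assign v (.const 0))
    (.loop (.sub e (.var v)) (.seq P (.assign v (.add (.var v) (.const 1)))))

/-- The rule for a `for` loop with at most `X` passes.  The body may not assign to the loop
variable, and the invariant may not depend on it; in each pass, everything that the loop does not mention as a
target still has its value from before the loop. -/
theorem Runs.forLoop {v : ℕ} {e : Expr} {P : Prog} {s : State} {N : ℕ} (I : ℕ → State → Prop)
    (hv : P.writesVar v = false) (hN : N ≤ X)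
    (he : ∀ s', Agree (forLoop v e P) s s' → e.eval s' = N)
    (hset : ∀ i s' w, I i s' → I i (s'.setVar v w)) (h₀ : I 0 s)
    (hI : ∀ i s', i < N → s'.var v = i → Agree (RAM.forLoop v e P) s s' → I i s' →
      Runs X P s' (I (i + 1))) :
    Runs X (RAM.forLoop v e P) s (I N) := by
  refine Runs.seq (Q := fun s' => I 0 s' ∧ s'.var v = 0)
    (Runs.assign ⟨hset _ _ _ h₀, by simp [State.setVar_var, Expr.eval]⟩) ?_
  rintro s₀ ha₀ ⟨hi₀, hv₀⟩
  have ha₀' : Agree (RAM.forLoop v e P) s s₀ :=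
    ha₀.mono (by simp +contextual [RAM.forLoop, Prog.writesVar]) (by simp [Prog.writesArr])
  refine (Runs.loop (fun i s' => i ≤ N ∧ s'.var v = i ∧ I i s' ∧ Agree (RAM.forLoop v e P) s s')
    ⟨by omega, hv₀, hi₀, ha₀'⟩ ?_ ?_).mono ?_
  · rintro i s' ⟨_, hvi, _, ha⟩ hc
    simp only [Expr.eval, he s' ha, hvi] at hc
    omega
  · rintro i s' - ⟨_, hvi, hi, ha⟩ hc
    simp only [Expr.eval, he s' ha, hvi] at hc
    refine Runs.seq (hI i s' (by omega) hvi ha hi) fun s₁ ha₁ h₁ => Runs.assign ?_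
    have hv₁ : s₁.var v = i := by rw [ha₁.var v hv, hvi]
    refine ⟨by omega, by simp [State.setVar_var, Expr.eval, hv₁], hset _ _ _ h₁, ?_⟩
    refine ha.trans ⟨fun w hw => ?_, fun a h => ?_⟩
    · simp only [RAM.forLoop, Prog.writesVar, Bool.or_eq_false_iff, beq_eq_false_iff_ne] at hw
      rw [State.setVar_var, if_neg hw.1, ha₁.var w hw.2.1]
    · simp only [RAM.forLoop, Prog.writesArr, Bool.or_false, Bool.false_or] at h
      rw [State.setVar_arr, ha₁.arr a h]
  · rintro s' - ⟨hc, i, hiN, hvi, hi, ha⟩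
    simp only [Expr.eval, he s' ha, hvi] at hc
    have : i = N := by omega
    exact this ▸ hi

/-- A loop that fills the segment of length `N` at address `B` of the array `A` with the values
`f 0, …, f (N - 1)`.  The values may be read from `A` itself, outside of that segment. -/
theorem Runs.fill {v A : ℕ} {e base val : Expr} {s : State} {N B : ℕ} (f : ℕ → ℕ) (hN : N ≤ X)
    (he : ∀ s', Agree (RAM.forLoop v e (.store A (.add base (.var v)) val)) s s' → e.eval s' = N)
    (hB : ∀ s', Agree (RAM.forLoop v e (.store A (.add base (.var v)) val)) s s' →
      base.eval s' = B)
    (hf : ∀ s' i, Agree (RAM.forLoop v e (.store A (.add base (.var v)) val)) s s' → i < N →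
      s'.var v = i → (∀ q, (q < B ∨ B + N ≤ q) → s'.arr A q = s.arr A q) → val.eval s' = f i) :
    Runs X (RAM.forLoop v e (.store A (.add base (.var v)) val)) s (fun s' =>
      (∀ i < N, s'.arr A (B + i) = f i) ∧
        ∀ q, (q < B ∨ B + N ≤ q) → s'.arr A q = s.arr A q) := by
  refine Runs.forLoop (fun i s' => (∀ i' < i, s'.arr A (B + i') = f i') ∧
    ∀ q, (q < B ∨ B + N ≤ q) → s'.arr A q = s.arr A q) rfl hN he (fun _ _ _ h => h)
    ⟨by simp, by simp⟩ ?_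
  rintro i s' hi hv ha ⟨h₁, h₂⟩
  refine Runs.store ?_
  simp only [Expr.eval, hB s' ha, hv, hf s' i ha hi hv h₂, State.setArr_arr]
  refine ⟨fun i' hi' => ?_, fun q hq => ?_⟩
  · split_ifs with h
    · rw [show i' = i by omega]
    · exact h₁ i' (by omega)
  · rw [if_neg (by omega), h₂ q hq]

/-- A loop that accumulates failures: the variable `w` stays `0` exactly if `φ i` holds for
all `i < N`. -/
theorem Runs.check {v w : ℕ} {e : Expr} {P : Prog} {s : State} {N : ℕ} (φ : ℕ → Prop)
    (hv : P.writesVar v = false) (hvw : w ≠ v) (hN : N ≤ X)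
    (he : ∀ s', Agree (RAM.forLoop v e P) s s' → e.eval s' = N)
    (hP : ∀ i s', i < N → s'.var v = i → Agree (RAM.forLoop v e P) s s' →
      Runs X P s' (fun s'' => s''.var w = 0 ↔ s'.var w = 0 ∧ φ i)) :
    Runs X (RAM.forLoop v e P) s (fun s' => s'.var w = 0 ↔ s.var w = 0 ∧ ∀ i < N, φ i) := by
  refine Runs.forLoop (fun i s' => s'.var w = 0 ↔ s.var w = 0 ∧ ∀ i' < i, φ i') hv hN he
    (fun i s' u h => by simpa [State.setVar_var, hvw] using h) (by simp) ?_
  intro i s' hi hvi ha h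
  refine (hP i s' hi hvi ha).mono fun s'' _ h' => ?_
  rw [h', h, and_assoc, Nat.forall_lt_succ_right]

theorem accumulate_eq_zero {s : State} {w : ℕ} {E : Expr} :
    (s.setVar w ((Expr.add (.var w) E).eval s)).var w = 0 ↔ s.var w = 0 ∧ E.eval s = 0 := by
  simp [State.setVar_var, Expr.eval]

/-- The distance `|e - f|`, which is `0` exactly if `e` and `f` have the same value. -/
def Expr.dist (e f : Expr) : Expr := .add (.sub e f) (.sub f e)

theorem Expr.dist_eval_eq_zero {e f : Expr} {s : State} :
    (e.dist f).eval s = 0 ↔ e.eval s = f.eval s := by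
  simp only [Expr.dist, Expr.eval]
  omega

end RAM

namespace RAM

/-! ### Listing the tuples of group elements -/

variable {X : ℕ} {n t : ℕ} {x : Fin t → Equiv.Perm (Fin n)} {G : Subgroup (Equiv.Perm (Fin n))}

theorem mul_add_lt_mul {k m l q : ℕ} (hk : k < m) (hq : q < l) : k * l + q < m * l :=
  calc k * l + q < k * l + l := by omega
    _ = (k + 1) * l := by ring
    _ ≤ m * l := Nat.mul_le_mul_right _ hk

/-- The part of the memory that stays fixed: the input, the table of the multiples of `n` in
array `3`, and the length `t * n` of an image list of a `t`-tuple of permutations in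
variable `4`. -/
structure Env (x : Fin t → Equiv.Perm (Fin n)) (s : State) : Prop where
  var_n : s.var 0 = n
  var_t : s.var 1 = t
  var_l : s.var 4 = t * n
  gens : ∀ (i : Fin t) (a : Fin n), s.arr 0 (i * n + a) = x i a
  rows : ∀ i : ℕ, i < t → s.arr 3 i = i * n

theorem Env.agree {P : Prog} {s s' : State} (h : Env x s) (ha : Agree P s s')
    (hP : (P.writesVar 0 || P.writesVar 1 || P.writesVar 4 || P.writesArr 0 || P.writesArr 3) =
      false := by rfl) : Env x s' := by
  simp only [Bool.or_eq_false_iff] at hP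
  obtain ⟨⟨⟨⟨h0, h1⟩, h4⟩, g0⟩, g3⟩ := hP
  refine ⟨?_, ?_, ?_, ?_, ?_⟩
  · rw [ha.var 0 h0, h.var_n]
  · rw [ha.var 1 h1, h.var_t]
  · rw [ha.var 4 h4, h.var_l]
  · rw [ha.arr 0 g0]; exact h.gens
  · rw [ha.arr 3 g3]; exact h.rows

/-- The memory holds the list `ys` of `t`-tuples of permutations: variable `5` is the length,
array `4` holds the image lists one after the other, and array `5` holds the addresses at which they
begin, including the address at which the next one would begin. -/
structure HoldsTuples (s : State) (ys : List (Fin t → Equiv.Perm (Fin n))) : Prop where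
  length : s.var 5 = ys.length
  start : ∀ k ≤ ys.length, s.arr 5 k = k * (t * n)
  entry : ∀ (k : ℕ) (hk : k < ys.length) (j : Fin t) (a : Fin n),
    s.arr 4 (k * (t * n) + (j * n + a)) = ys[k] j a

theorem HoldsTuples.agree {P : Prog} {s s' : State} {ys : List (Fin t → Equiv.Perm (Fin n))}
    (h : HoldsTuples s ys) (ha : Agree P s s')
    (hP : (P.writesVar 5 || P.writesArr 4 || P.writesArr 5) = false := by rfl) :
    HoldsTuples s' ys := by
  simp only [Bool.or_eq_false_iff] at hP
  obtain ⟨⟨h5, g4⟩, g5⟩ := hP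
  refine ⟨?_, ?_, ?_⟩
  · rw [ha.var 5 h5, h.length]
  · rw [ha.arr 5 g5]; exact h.start
  · rw [ha.arr 4 g4]; exact h.entry

/-- Multiply the entry `j` of a tuple from the left by the generator `x i`. -/
def move (x : Fin t → Equiv.Perm (Fin n)) (j i : Fin t) (y : Fin t → Equiv.Perm (Fin n)) :
    Fin t → Equiv.Perm (Fin n) :=
  Function.update y j (x i * y j)

/-- Write the tuple with index `k = var 6`, moved by `move x (var 7) (var 8)`, behind the end of the
list. -/
def writeMoved : Prog :=
  .seq
    (forLoop 9 (.var 4) (.store 4 (.add (.read 5 (.var 5)) (.var 9))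
      (.read 4 (.add (.read 5 (.var 6)) (.var 9)))))
    (forLoop 9 (.var 0) (.store 4 (.add (.add (.read 5 (.var 5)) (.read 3 (.var 7))) (.var 9))
      (.read 0 (.add (.read 3 (.var 8))
        (.read 4 (.add (.read 5 (.var 6)) (.add (.read 3 (.var 7)) (.var 9))))))))

theorem writeMoved_runs {s : State} {ys : List (Fin t → Equiv.Perm (Fin n))} {k : ℕ} {j i : Fin t}
    (hn : n ≤ X) (hl : t * n ≤ X) (henv : Env x s) (hys : HoldsTuples s ys) (hk : k < ys.length)
    (h6 : s.var 6 = k) (h7 : s.var 7 = j) (h8 : s.var 8 = i) :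
    Runs X writeMoved s (fun s' => HoldsTuples s' ys ∧ ∀ (j' : Fin t) (a : Fin n),
      s'.arr 4 (ys.length * (t * n) + (j' * n + a)) = move x j i ys[k] j' a) := by
  have hja : ∀ (j : Fin t) (a : Fin n), (j : ℕ) * n + a < t * n :=
    fun j a => mul_add_lt_mul j.2 a.2
  refine Runs.seq (Runs.fill (B := ys.length * (t * n))
    (fun q => s.arr 4 (k * (t * n) + q)) hl ?_ ?_ ?_) ?_
  · intro s' ha
    exact (henv.agree ha).var_l
  · intro s' ha
    simp only [Expr.eval, ha.arr 5 rfl, ha.var 5 rfl, hys.length]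
    exact hys.start _ le_rfl
  · intro s' q ha hq hv hout
    simp only [Expr.eval, ha.arr 5 rfl, ha.var 6 rfl, h6, hv, hys.start k hk.le]
    exact hout _ (Or.inl (mul_add_lt_mul hk hq))
  intro s₁ ha₁ ⟨hin, hout⟩
  have henv₁ := henv.agree ha₁
  have hys₁ : HoldsTuples s₁ ys := by
    refine ⟨by rw [ha₁.var 5 rfl, hys.length], by rw [ha₁.arr 5 rfl]; exact hys.start, ?_⟩
    intro k' hk' j' a
    rw [hout _ (Or.inl (mul_add_lt_mul hk' (hja j' a))), hys.entry]
  have hcopy : ∀ (j' : Fin t) (a : Fin n),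
      s₁.arr 4 (ys.length * (t * n) + (j' * n + a)) = ys[k] j' a := fun j' a => by
    rw [hin _ (hja j' a), hys.entry]
  refine (Runs.fill (B := ys.length * (t * n) + j * n)
    (fun q => if h : q < n then x i (ys[k] j ⟨q, h⟩) else 0) hn ?_ ?_ ?_).mono ?_
  · intro s' ha
    exact (henv₁.agree ha).var_n
  · intro s' ha
    simp only [Expr.eval, ha.arr 5 rfl, ha.var 5 rfl, hys₁.length, ha.var 7 rfl, ha.arr 3 rfl,
      ha₁.var 7 rfl, h7, henv₁.rows j j.2, hys₁.start _ le_rfl]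
  · intro s' q ha hq hv hout'
    have h := hys₁.entry k hk j ⟨q, hq⟩
    have hlt : k * (t * n) + (j * n + q) < ys.length * (t * n) + j * n :=
      (mul_add_lt_mul hk (hja j ⟨q, hq⟩)).trans_le (Nat.le_add_right _ _)
    simp only [Expr.eval, ha.arr 5 rfl, ha.var 6 rfl, ha.var 7 rfl, ha.var 8 rfl, ha.arr 3 rfl,
      ha.arr 0 rfl, ha₁.var 6 rfl, ha₁.var 7 rfl, ha₁.var 8 rfl, h6, h7, h8, hv,
      hys₁.start k hk.le, henv₁.rows j j.2, henv₁.rows i i.2, hout' _ (Or.inl hlt), dif_pos hq]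
    rw [h, henv₁.gens]
  · intro s₂ ha₂ ⟨hin₂, hout₂⟩
    refine ⟨⟨by rw [ha₂.var 5 rfl, hys₁.length], by rw [ha₂.arr 5 rfl]; exact hys₁.start, ?_⟩, ?_⟩
    · intro k' hk' j' a
      rw [hout₂ _ (Or.inl ((mul_add_lt_mul hk' (hja j' a)).trans_le (Nat.le_add_right _ _))),
        hys₁.entry]
    · intro j' a
      by_cases hj : j' = j
      · subst hj
        rw [← add_assoc, hin₂ _ a.2]
        simp [move]
      · rw [hout₂, hcopy]
        · simp [move, hj]
        · have := a.2
          rcases lt_or_gt_of_ne (fun h => hj (Fin.ext h) : (j' : ℕ) ≠ j) with h | h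
          · left
            have := mul_add_lt_mul (l := n) h a.2
            omega
          · right
            have : (j + 1 : ℕ) * n ≤ j' * n := Nat.mul_le_mul_right _ h
            rw [Nat.add_mul] at this
            omega

/-- Search the list for the tuple that is written behind its end; variable `11` becomes nonzero if
it is found. -/
def search : Prog :=
  .seq (.assign 11 (.const 0)) (forLoop 12 (.var 5)
    (.seq (.assign 10 (.const 0))
      (.seq (forLoop 9 (.var 4) (.assign 10 (.add (.var 10)
          (Expr.dist (.read 4 (.add (.read 5 (.var 12)) (.var 9)))
            (.read 4 (.add (.read 5 (.var 5)) (.var 9)))))))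
        (.assign 11 (.add (.var 11) (.sub (.const 1) (.var 10)))))))

/-- The image lists are compared through the sum of the distances of their entries, which is stored
in variable `10`. -/
theorem search_runs {s : State} {ys : List (Fin t → Equiv.Perm (Fin n))}
    {w : Fin t → Equiv.Perm (Fin n)} (hl : t * n ≤ X) (hlen : ys.length ≤ X) (henv : Env x s)
    (hys : HoldsTuples s ys) (hw : ∀ (j : Fin t) (a : Fin n),
      s.arr 4 (ys.length * (t * n) + (j * n + a)) = w j a) :
    Runs X search s (fun s' => s'.var 11 = 0 ↔ w ∉ ys) := by
  refine Runs.seq (Q := fun s' => s'.var 11 = 0) (Runs.assign rfl) ?_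
  intro s₁ ha₁ h11
  have henv₁ := henv.agree ha₁
  have hys₁ := hys.agree ha₁
  rw [← ha₁.arr 4 rfl] at hw
  clear ha₁ henv hys
  refine (Runs.check (w := 11) (fun p => ∀ h : p < ys.length, ys[p] ≠ w) rfl (by decide) hlen ?_
    ?_).mono ?_
  · intro s' ha
    simp only [Expr.eval]
    rw [ha.var 5 rfl, hys₁.length]
  · intro p s' hp hv ha
    have henv₂ := henv₁.agree ha
    have hys₂ := hys₁.agree ha
    rw [← ha.arr 4 rfl] at hw
    refine Runs.seq (Q := fun s' => s'.var 10 = 0) (Runs.assign rfl) ?_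
    intro s₃ ha₃ h10
    rw [← ha₃.var 12 rfl] at hv
    rw [← ha₃.arr 4 rfl] at hw
    rw [← ha₃.var 11 rfl]
    have henv₃ := henv₂.agree ha₃
    have hys₃ := hys₂.agree ha₃
    clear ha₃ henv₂ hys₂
    refine Runs.seq (Runs.check (w := 10) (N := t * n)
      (fun q => s₃.arr 4 (p * (t * n) + q) = s₃.arr 4 (ys.length * (t * n) + q)) rfl (by decide) hl
      ?_ ?_) ?_
    · intro s' ha
      exact (henv₃.agree ha).var_l
    · intro q s' hq hv' ha'
      refine Runs.assign ?_
      rw [accumulate_eq_zero, Expr.dist_eval_eq_zero]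
      simp only [Expr.eval]
      rw [hv', ha'.arr 4 rfl, ha'.arr 5 rfl, ha'.var 5 rfl, ha'.var 12 rfl, hv, hys₃.length,
        hys₃.start _ le_rfl, hys₃.start _ hp.le]
    · intro s₄ ha₄ h₄
      refine Runs.assign ?_
      have h₅ : s₄.var 10 = 0 ↔ ys[p] = w := by
        rw [h₄, and_iff_right h10]
        constructor
        · intro h
          ext j a
          rw [← hys₃.entry p hp, ← hw]
          exact h _ (mul_add_lt_mul j.2 a.2)
        · rintro rfl q hq
          have hn : 0 < n := by
            rcases Nat.eq_zero_or_pos n with rfl | h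
            · simp at hq
            · exact h
          have e := hys₃.entry p hp ⟨q / n, Nat.div_lt_of_lt_mul (by rwa [mul_comm])⟩
            ⟨q % n, Nat.mod_lt _ hn⟩
          rw [← hw] at e
          simpa only [Nat.div_add_mod'] using e
      have h₆ : s₄.var 11 = s₃.var 11 := ha₄.var 11 rfl
      simp only [State.setVar_var, Expr.eval, if_true, h₆, Nat.add_eq_zero_iff]
      refine and_congr_right fun _ => ?_
      rw [forall_prop_of_true hp, ne_eq, ← h₅]
      omega
  · intro s' _ h
    rw [h, and_iff_right h11]
    rw [List.mem_iff_getElem]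
    push Not
    exact ⟨fun h p hp => h p hp hp, fun h p _ hp => h p hp⟩

/-- Append the moved tuple to the list, unless it is there already. -/
def tryMove : Prog :=
  .seq writeMoved (.seq search (.cond (.var 11) .skip
    (.seq (.store 5 (.add (.var 5) (.const 1)) (.add (.read 5 (.var 5)) (.var 4)))
      (.assign 5 (.add (.var 5) (.const 1))))))

theorem tryMove_runs {s : State} {ys : List (Fin t → Equiv.Perm (Fin n))} {k : ℕ} {j i : Fin t}
    (hn : n ≤ X) (hl : t * n ≤ X) (hlen : ys.length ≤ X) (henv : Env x s) (hys : HoldsTuples s ys)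
    (hk : k < ys.length) (h6 : s.var 6 = k) (h7 : s.var 7 = j) (h8 : s.var 8 = i) :
    Runs X tryMove s (fun s' => (move x j i ys[k] ∈ ys ∧ HoldsTuples s' ys) ∨
      (move x j i ys[k] ∉ ys ∧ HoldsTuples s' (ys ++ [move x j i ys[k]]))) := by
  refine Runs.seq (writeMoved_runs hn hl henv hys hk h6 h7 h8) fun s₁ ha₁ ⟨hys₁, hw₁⟩ => ?_
  have henv₁ := henv.agree ha₁
  refine Runs.seq (search_runs hl hlen henv₁ hys₁ hw₁) fun s₂ ha₂ h₂ => ?_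
  rw [← ha₂.arr 4 rfl] at hw₁
  have henv₂ := henv₁.agree ha₂
  have hys₂ := hys₁.agree ha₂
  refine Runs.cond (fun hc => Runs.skip (Or.inl ⟨?_, hys₂⟩)) fun hc => ?_
  · exact not_not.1 (mt h₂.2 hc)
  refine Runs.seq (Q := fun s' => s' = s₂.setArr 5 (ys.length + 1) ((ys.length + 1) * (t * n)))
    (Runs.store ?_) ?_
  · simp only [Expr.eval, hys₂.length, hys₂.start _ le_rfl, henv₂.var_l, Nat.add_mul, one_mul]
  rintro s₃ - rfl
  refine Runs.assign (Or.inr ⟨h₂.1 hc, ?_, ?_, ?_⟩)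
  · simp [State.setVar_var, Expr.eval, hys₂.length]
  · intro k' hk'
    simp only [List.length_append, List.length_singleton] at hk'
    rw [State.setVar_arr, State.setArr_arr]
    split_ifs with h
    · rw [h]
    · exact hys₂.start k' (by omega)
  · intro k' hk' j' a
    rw [State.setVar_arr, State.setArr_arr_of_ne _ _ _ (by decide), List.getElem_append]
    split_ifs with h
    · exact hys₂.entry k' h j' a
    · simp only [List.length_append, List.length_singleton] at hk'
      obtain rfl : k' = ys.length := by omega
      rw [hw₁]
      simp

/-- A list of distinct `t`-tuples of elements of `G`. -/
structure IsTupleList (G : Subgroup (Equiv.Perm (Fin n)))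
    (ys : List (Fin t → Equiv.Perm (Fin n))) : Prop where
  nodup : ys.Nodup
  mem : ∀ y ∈ ys, ∀ j, y j ∈ G

/-- Append all moved versions of the tuple with index `var 6`. -/
def tryMoves : Prog := forLoop 7 (.var 1) (forLoop 8 (.var 1) tryMove)

theorem tryMoves_runs {s : State} {ys : List (Fin t → Equiv.Perm (Fin n))} {k : ℕ}
    (hn : n ≤ X) (ht : t ≤ X) (hl : t * n ≤ X)
    (hX : ∀ ys : List (Fin t → Equiv.Perm (Fin n)), IsTupleList G ys → ys.length ≤ X)
    (hx : ∀ i, x i ∈ G) (henv : Env x s) (hys : HoldsTuples s ys) (hG : IsTupleList G ys)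
    (hk : k < ys.length) (h6 : s.var 6 = k) :
    Runs X tryMoves s (fun s' => ∃ ys', ys <+: ys' ∧ HoldsTuples s' ys' ∧ IsTupleList G ys' ∧
      ∀ j i, move x j i ys[k] ∈ ys') := by
  refine (Runs.forLoop (N := t) (fun j s' => ∃ ys', ys <+: ys' ∧ HoldsTuples s' ys' ∧
    IsTupleList G ys' ∧ ∀ j' : Fin t, (j' : ℕ) < j → ∀ i, move x j' i ys[k] ∈ ys') rfl ht ?_ ?_
    ⟨ys, List.prefix_rfl, hys, hG, by simp⟩ ?_).mono ?_
  · intro s' ha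
    exact (henv.agree ha).var_t
  · rintro i s' w ⟨ys', hp, h, h'⟩
    exact ⟨ys', hp, ⟨h.length, h.start, h.entry⟩, h'⟩
  · rintro j s₁ hj h7 ha₁ ⟨ys₁, hp₁, hys₁, hG₁, hm₁⟩
    have henv₁ := henv.agree ha₁
    refine (Runs.forLoop (N := t) (fun i s' => ∃ ys', ys₁ <+: ys' ∧ HoldsTuples s' ys' ∧
      IsTupleList G ys' ∧ ∀ i' : Fin t, (i' : ℕ) < i → move x ⟨j, hj⟩ i' ys[k] ∈ ys') rfl ht ?_ ?_
      ⟨ys₁, List.prefix_rfl, hys₁, hG₁, by simp⟩ ?_).mono ?_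
    · intro s' ha
      exact (henv₁.agree ha).var_t
    · rintro i s' w ⟨ys', hp, h, h'⟩
      exact ⟨ys', hp, ⟨h.length, h.start, h.entry⟩, h'⟩
    · rintro i s₂ hi h8 ha₂ ⟨ys₂, hp₂, hys₂, hG₂, hm₂⟩
      have hp := hp₁.trans hp₂
      have hk₂ : k < ys₂.length := hk.trans_le hp.length_le
      have hget : ys₂[k] = ys[k] := (hp.getElem hk).symm
      have := tryMove_runs (X := X) (j := ⟨j, hj⟩) (i := ⟨i, hi⟩) hn hl (hX _ hG₂)
        (henv₁.agree ha₂) hys₂ hk₂ (by rw [ha₂.var 6 rfl, ha₁.var 6 rfl, h6])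
        (by rw [ha₂.var 7 rfl, h7]) (by rw [h8])
      rw [hget] at this
      refine this.mono fun s₃ ha₃ h₃ => ?_
      have hlast : ∀ ys₃, ys₂ <+: ys₃ → move x ⟨j, hj⟩ ⟨i, hi⟩ ys[k] ∈ ys₃ →
          ∀ i' : Fin t, (i' : ℕ) < i + 1 → move x ⟨j, hj⟩ i' ys[k] ∈ ys₃ := by
        intro ys₃ hp₃ hm i' hi'
        rcases Nat.lt_succ_iff_lt_or_eq.1 hi' with h | h
        · exact hp₃.subset (hm₂ i' h)
        · rwa [show i' = ⟨i, hi⟩ from Fin.ext h]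
      rcases h₃ with ⟨hm, h₃⟩ | ⟨hm, h₃⟩
      · exact ⟨ys₂, hp₂, h₃, hG₂, hlast _ List.prefix_rfl hm⟩
      · refine ⟨_, hp₂.trans (List.prefix_append _ _), h₃, ⟨?_, ?_⟩,
          hlast _ (List.prefix_append _ _) (by simp)⟩
        · refine List.nodup_append.2 ⟨hG₂.nodup, List.nodup_singleton _, ?_⟩
          rintro a ha b hb rfl
          exact hm (List.mem_singleton.1 hb ▸ ha)
        · intro y hy
          rcases List.mem_append.1 hy with hy | hy
          · exact hG₂.mem y hy
          · rw [List.mem_singleton.1 hy]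
            have hmem := hG₁.mem _ (hp₁.subset (List.getElem_mem hk))
            intro j'
            by_cases h : j' = ⟨j, hj⟩
            · subst h
              simpa [move] using G.mul_mem (hx _) (hmem _)
            · simpa [move, h] using hmem j'
    · rintro s₂ - ⟨ys₂, hp₂, hys₂, hG₂, hm₂⟩
      refine ⟨ys₂, hp₁.trans hp₂, hys₂, hG₂, fun j' hj' i => ?_⟩
      rcases Nat.lt_succ_iff_lt_or_eq.1 hj' with h | h
      · exact hp₂.subset (hm₁ j' h i)
      · rw [show j' = ⟨j, hj⟩ from Fin.ext h]
        exact hm₂ i i.2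
  · rintro s' - ⟨ys', hp, h, hG', hm⟩
    exact ⟨ys', hp, h, hG', fun j i => hm j j.2 i⟩

/-- Close the list under all moves. -/
def closeList : Prog :=
  .seq (.assign 6 (.const 0))
    (.loop (.sub (.var 5) (.var 6)) (.seq tryMoves (.assign 6 (.add (.var 6) (.const 1)))))

theorem closeList_runs {s : State} {ys : List (Fin t → Equiv.Perm (Fin n))}
    (hn : n ≤ X) (ht : t ≤ X) (hl : t * n ≤ X)
    (hX : ∀ ys : List (Fin t → Equiv.Perm (Fin n)), IsTupleList G ys → ys.length ≤ X)
    (hx : ∀ i, x i ∈ G) (henv : Env x s) (hys : HoldsTuples s ys) (hG : IsTupleList G ys) :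
    Runs X closeList s (fun s' => ∃ ys', ys <+: ys' ∧ HoldsTuples s' ys' ∧ IsTupleList G ys' ∧
      ∀ y ∈ ys', ∀ j i, move x j i y ∈ ys') := by
  refine Runs.seq (Q := fun s' => s'.var 6 = 0) (Runs.assign rfl) fun s₁ ha₁ h₁ => ?_
  have henv₁ := henv.agree ha₁
  have hys₁ := hys.agree ha₁
  refine (Runs.loop (fun k s' => s'.var 6 = k ∧ ∃ ys', ys <+: ys' ∧ HoldsTuples s' ys' ∧
    IsTupleList G ys' ∧ k ≤ ys'.length ∧
    ∀ p (h : p < ys'.length), p < k → ∀ j i, move x j i ys'[p] ∈ ys')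
    ⟨h₁, ys, List.prefix_rfl, hys₁, hG, by simp, by simp⟩ ?_ ?_).mono ?_
  · -- The list has no repetitions, so its length bounds the number of passes.
    rintro k s' ⟨h6, ys', -, hys', hG', -, -⟩ hc
    have := hX _ hG'
    simp only [Expr.eval, h6, hys'.length] at hc
    omega
  · rintro k s₂ ha₂ ⟨h6, ys₂, hp₂, hys₂, hG₂, -, hm₂⟩ hc
    simp only [Expr.eval, h6, hys₂.length] at hc
    refine Runs.seq (tryMoves_runs hn ht hl hX hx (henv₁.agree ha₂) hys₂ hG₂
      (by omega : k < ys₂.length) h6) ?_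
    rintro s₃ ha₃ ⟨ys₃, hp₃, hys₃, hG₃, hm₃⟩
    have hle := hp₃.length_le
    have h6' : s₃.var 6 = k := by rw [ha₃.var 6 rfl, h6]
    refine Runs.assign ⟨by simp [State.setVar_var, Expr.eval, h6'], ys₃, hp₂.trans hp₃,
      ⟨hys₃.length, hys₃.start, hys₃.entry⟩, hG₃, by omega, fun p hp hpk j i => ?_⟩
    have hp' : p < ys₂.length := by omega
    rw [← hp₃.getElem hp']
    rcases Nat.lt_succ_iff_lt_or_eq.1 hpk with h | rfl
    · exact hp₃.subset (hm₂ p hp' h j i)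
    · exact hm₃ j i
  · rintro s' - ⟨hc, k, h6, ys', hp, hys', hG', -, hm⟩
    simp only [Expr.eval, h6, hys'.length] at hc
    refine ⟨ys', hp, hys', hG', fun y hy j i => ?_⟩
    obtain ⟨p, hp, rfl⟩ := List.getElem_of_mem hy
    exact hm p hp (by omega) j i

/-- Write the table of multiples of `n` and the list consisting of the tuple of identities. -/
def setup : Prog :=
  .seq (forLoop 8 (.var 1)
      (.store 3 (.add (.var 8) (.const 1)) (.add (.read 3 (.var 8)) (.var 0))))
    (.seq (.assign 4 (.read 3 (.var 1)))
      (.seq (forLoop 7 (.var 1) (forLoop 14 (.var 0)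
          (.store 4 (.add (.read 3 (.var 7)) (.var 14)) (.var 14))))
        (.seq (.assign 5 (.const 1)) (.store 5 (.const 1) (.var 4)))))

theorem setup_runs {b : ℕ} (hn : n ≤ X) (ht : t ≤ X) (β : Fin b → Fin n) :
    Runs X setup (initial x β) (fun s => Env x s ∧ HoldsTuples s [(1 : Fin t → Equiv.Perm (Fin n))])
    := by
  have hx0 := initial_perm x β
  have hv0 : (initial x β).var 0 = n := rfl
  have hv1 : (initial x β).var 1 = t := rfl
  have h3 : (initial x β).arr 3 0 = 0 := rfl
  have h5 : (initial x β).arr 5 0 = 0 := rfl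
  generalize initial x β = s at *
  refine Runs.seq (Runs.forLoop (N := t) (fun i s' => ∀ i' ≤ i, s'.arr 3 i' = i' * n) rfl ht
    ?_ (fun _ _ _ h => h) ?_ ?_) ?_
  · intro s' ha
    simp only [Expr.eval]
    rw [ha.var 1 rfl, hv1]
  · intro i' hi'
    rw [Nat.le_zero.1 hi', h3, zero_mul]
  · intro i s' hi h8 ha h
    refine Runs.store fun i' hi' => ?_
    simp only [State.setArr_arr, Expr.eval, h8, ha.var 0 rfl, hv0]
    split_ifs with h'
    · rw [h', h i le_rfl, Nat.add_mul, one_mul]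
    · exact h i' (by omega)
  intro s₁ ha₁ hrows
  rw [← ha₁.var 0 rfl] at hv0
  rw [← ha₁.var 1 rfl] at hv1
  rw [← ha₁.arr 0 rfl] at hx0
  rw [← ha₁.arr 5 rfl] at h5
  clear ha₁
  refine Runs.seq (Q := fun s' => Env x s' ∧ s'.arr 5 0 = 0) (Runs.assign ⟨?_, h5⟩) ?_
  · refine ⟨hv0, hv1, ?_, hx0, fun i hi => hrows i hi.le⟩
    simp [State.setVar_var, Expr.eval, hv1, hrows t le_rfl]
  clear h5
  rintro s₂ - ⟨henv, h5⟩
  refine Runs.seq (Runs.forLoop (N := t) (fun j s' => ∀ (j' : Fin t) (a : Fin n), (j' : ℕ) < j →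
    s'.arr 4 (j' * n + a) = a) rfl ht ?_ (fun _ _ _ h => h) (by simp) ?_) ?_
  · intro s' ha
    exact (henv.agree ha).var_t
  · intro j s' hj h7 ha h
    have henv' := henv.agree ha
    refine (Runs.fill (B := j * n) (fun q => q) hn ?_ ?_ ?_).mono ?_
    · intro s' ha
      exact (henv'.agree ha).var_n
    · intro s₃ ha₃
      simp only [Expr.eval]
      rw [ha₃.arr 3 rfl, ha₃.var 7 rfl, h7, henv'.rows j hj]
    · intro s₃ q _ _ hv _
      exact hv
    · rintro s₃ - ⟨hin, hout⟩ j' a hj'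
      rcases Nat.lt_succ_iff_lt_or_eq.1 hj' with h' | h'
      · rw [hout _ (Or.inl (mul_add_lt_mul h' a.2)), h j' a h']
      · rw [h', hin a a.2]
  · intro s₃ ha₃ h4
    have henv₃ := henv.agree ha₃
    rw [← ha₃.arr 5 rfl] at h5
    refine Runs.seq (Q := fun s' => s' = s₃.setVar 5 1) (Runs.assign rfl) ?_
    rintro s₄ ha₄ rfl
    have henv₄ := henv₃.agree ha₄
    refine Runs.store ⟨⟨henv₄.var_n, henv₄.var_t, henv₄.var_l, henv₄.gens, henv₄.rows⟩,
      rfl, ?_, ?_⟩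
    · intro k hk
      simp only [List.length_singleton] at hk
      rw [State.setArr_arr]
      simp only [Expr.eval, henv₄.var_l]
      split_ifs with h
      · rw [h, one_mul]
      · rw [show k = 0 by omega, zero_mul]
        exact h5
    · intro k hk j a
      simp only [List.length_singleton] at hk
      obtain rfl : k = 0 := by omega
      rw [zero_mul, zero_add]
      exact h4 j a j.2

end RAM

namespace RAM

/-! ### Constructing the normalising permutations -/

variable {X : ℕ} {n t : ℕ} {x y : Fin t → Equiv.Perm (Fin n)}
  {ys : List (Fin t → Equiv.Perm (Fin n))} {k c : ℕ}

/-- The permutation `σ` conjugates the tuple `x` to the tuple `y`. -/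
def Conjugates (x y : Fin t → Equiv.Perm (Fin n)) (σ : Equiv.Perm (Fin n)) : Prop :=
  ∀ i a, σ (x i a) = y i (σ a)

/-- With `i = var 8`, `a = var 14`, and `y` the tuple with index `var 6`, this is the value of `y i`
at the point which array `6` assigns to `a`.  Array `6` holds points plus one,
with `0` for unknown values. -/
def imageExpr : Expr :=
  .read 4 (.add (.read 5 (.var 6)) (.add (.read 3 (.var 8)) (.sub (.read 6 (.var 14)) (.const 1))))

theorem imageExpr_eval {s : State} {i : Fin t} {a : ℕ} (henv : Env x s) (hys : HoldsTuples s ys)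
    (hk : k < ys.length) (h6 : s.var 6 = k) (h8 : s.var 8 = i) (h14 : s.var 14 = a) (d : Fin n)
    (hd : s.arr 6 a - 1 = d) : imageExpr.eval s = ys[k] i d := by
  simp only [imageExpr, Expr.eval, h6, h8, h14, hd, henv.rows i i.2, hys.start k hk.le]
  exact hys.entry k hk i d

/-- Propagate the value at the point `a = var 14` along all generators. -/
def propagatePoint : Prog :=
  forLoop 8 (.var 1) (.cond (.read 6 (.var 14))
    (.store 6 (.read 0 (.add (.read 3 (.var 8)) (.var 14))) (.add imageExpr (.const 1))) .skip)

/-- One round of propagation. -/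
def propagate : Prog := forLoop 14 (.var 0) propagatePoint

/-- Start with the value `c = var 13` at the point `0`, and propagate `n` times. -/
def build : Prog :=
  .seq (forLoop 14 (.var 0) (.store 6 (.add (.const 0) (.var 14)) (.const 0)))
    (.seq (.store 6 (.const 0) (.add (.var 13) (.const 1))) (forLoop 15 (.var 0) propagate))

/-- Array `6` holds a part of every permutation that conjugates `x` to `y` and maps `0` to `c`. -/
structure HoldsPartial (x y : Fin t → Equiv.Perm (Fin n)) (c : ℕ) (s : State) : Prop where
  le : ∀ a : Fin n, s.arr 6 a ≤ n
  eq : ∀ σ, Conjugates x y σ → (∀ a : Fin n, (a : ℕ) = 0 → (σ a : ℕ) = c) →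
    ∀ a : Fin n, s.arr 6 a ≠ 0 → s.arr 6 a = σ a + 1

/-- The set of points at which array `6` holds a value. -/
def support (n : ℕ) (s : State) : Finset (Fin n) := {a | s.arr 6 a ≠ 0}

theorem mem_support {s : State} {a : Fin n} : a ∈ support n s ↔ s.arr 6 a ≠ 0 := by
  simp [support]

/-- Every `σ` that conjugates `x` to `y` satisfies `σ (x i a) = y i (σ a)`, so the value at `a`
determines the one at `x i a`. -/
theorem propagatePoint_runs {s : State} (ht : t ≤ X) (henv : Env x s) (hys : HoldsTuples s ys)
    (hk : k < ys.length) (h6 : s.var 6 = k) (a : Fin n) (h14 : s.var 14 = a)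
    (hS : HoldsPartial x ys[k] c s) :
    Runs X propagatePoint s (fun s' => HoldsPartial x ys[k] c s' ∧ support n s ⊆ support n s' ∧
      (a ∈ support n s → ∀ i, x i a ∈ support n s')) := by
  refine (Runs.forLoop (N := t) (fun i s' => HoldsPartial x ys[k] c s' ∧
    support n s ⊆ support n s' ∧
    (a ∈ support n s → ∀ i' : Fin t, (i' : ℕ) < i → x i' a ∈ support n s')) rfl ht ?_
    (fun _ _ _ h => ⟨⟨h.1.le, h.1.eq⟩, h.2⟩) ⟨hS, subset_rfl, by simp⟩ ?_).mono ?_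
  · intro s' ha
    exact (henv.agree ha).var_t
  · rintro i s' hi h8 ha ⟨hS', hsub, hm⟩
    have henv' := henv.agree ha
    have h14' : s'.var 14 = a := by rw [ha.var 14 rfl, h14]
    refine Runs.cond (fun hc => ?_) (fun hc => Runs.skip ⟨hS', hsub, fun h => ?_⟩)
    · simp only [Expr.eval, h14'] at hc
      have hle := hS'.le a
      have himg := imageExpr_eval (i := ⟨i, hi⟩) henv' (hys.agree ha) hk
        (by rw [ha.var 6 rfl, h6]) h8 h14' ⟨s'.arr 6 a - 1, by omega⟩ rfl
      have hidx : (Expr.read 0 (.add (.read 3 (.var 8)) (.var 14))).eval s' = x ⟨i, hi⟩ a := by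
        simp only [Expr.eval, h8, h14', henv'.rows i hi]
        exact henv'.gens ⟨i, hi⟩ a
      have harr : ∀ b : Fin n, (s'.setArr 6
          ((Expr.read 0 (.add (.read 3 (.var 8)) (.var 14))).eval s')
          ((Expr.add imageExpr (.const 1)).eval s')).arr 6 b =
          if b = x ⟨i, hi⟩ a then (ys[k] ⟨i, hi⟩ ⟨s'.arr 6 a - 1, by omega⟩ : ℕ) + 1
          else s'.arr 6 b := fun b => by
        rw [State.setArr_arr, hidx, Expr.eval, himg]
        simp only [Fin.ext_iff, Expr.eval]
      refine Runs.store ⟨⟨fun b => ?_, fun σ hσ hσ0 b => ?_⟩, fun b hb => ?_, fun h i' hi' => ?_⟩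
      · rw [harr]
        split_ifs
        · exact (ys[k] ⟨i, hi⟩ _).2
        · exact hS'.le b
      · rw [harr]
        split_ifs with h
        · intro _
          have e : (⟨s'.arr 6 a - 1, by omega⟩ : Fin n) = σ a :=
            Fin.ext (by simp [hS'.eq σ hσ hσ0 a hc])
          rw [e, h, hσ]
        · exact hS'.eq σ hσ hσ0 b
      · rw [mem_support, harr]
        split_ifs
        · omega
        · exact mem_support.1 (hsub hb)
      · rw [mem_support, harr]
        split_ifs with h'
        · omega
        · rcases Nat.lt_succ_iff_lt_or_eq.1 hi' with h'' | h''
          · exact mem_support.1 (hm h i' h'')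
          · exact absurd (by rw [show i' = ⟨i, hi⟩ from Fin.ext h'']) h'
    · simp only [Expr.eval, h14'] at hc
      exact absurd hc (mem_support.1 (hsub h))
  · rintro s' - ⟨h₁, h₂, h₃⟩
    exact ⟨h₁, h₂, fun h i => h₃ h i i.2⟩

theorem propagate_runs {s : State} (hn : n ≤ X) (ht : t ≤ X) (henv : Env x s)
    (hys : HoldsTuples s ys) (hk : k < ys.length) (h6 : s.var 6 = k)
    (hS : HoldsPartial x ys[k] c s) :
    Runs X propagate s (fun s' => HoldsPartial x ys[k] c s' ∧ support n s ⊆ support n s' ∧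
      ∀ a ∈ support n s, ∀ i, x i a ∈ support n s') := by
  refine (Runs.forLoop (N := n) (fun q s' => HoldsPartial x ys[k] c s' ∧
    support n s ⊆ support n s' ∧ ∀ a ∈ support n s, (a : ℕ) < q → ∀ i, x i a ∈ support n s') rfl hn
    ?_ (fun _ _ _ h => ⟨⟨h.1.le, h.1.eq⟩, h.2⟩) ⟨hS, subset_rfl, by simp⟩ ?_).mono ?_
  · intro s' ha
    exact (henv.agree ha).var_n
  · rintro q s' hq h14 ha ⟨hS', hsub, hm⟩
    refine (propagatePoint_runs ht (henv.agree ha) (hys.agree ha) hk (by rw [ha.var 6 rfl, h6])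
      ⟨q, hq⟩ h14 hS').mono ?_
    rintro s'' - ⟨hS'', hsub', hm'⟩
    refine ⟨hS'', hsub.trans hsub', fun a h haq i => ?_⟩
    rcases Nat.lt_succ_iff_lt_or_eq.1 haq with h' | h'
    · exact hsub' (hm a h h' i)
    · obtain rfl : a = ⟨q, hq⟩ := Fin.ext h'
      exact hm' (hsub h) i
  · rintro s' - ⟨h₁, h₂, h₃⟩
    exact ⟨h₁, h₂, fun a h i => h₃ a h a.2 i⟩

/-- The condition that the generators `x i` generate a transitive group, in the form in which it is
used: only the full set of points is nonempty and closed under all generators. -/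
def OnlyFullClosed (x : Fin t → Equiv.Perm (Fin n)) : Prop :=
  ∀ D : Finset (Fin n), D.Nonempty → (∀ a ∈ D, ∀ i, x i a ∈ D) → D = Finset.univ

/-- The rounds of propagation reach every point, since a round which adds no point shows that the
set of points reached is closed under the generators. -/
theorem build_runs {s : State} (hn : n ≤ X) (ht : t ≤ X) (hx : OnlyFullClosed x) (henv : Env x s)
    (hys : HoldsTuples s ys) (hk : k < ys.length) (h6 : s.var 6 = k) (h13 : s.var 13 = c)
    (hc : c < n) :
    Runs X build s (fun s' => HoldsPartial x ys[k] c s' ∧ ∀ a : Fin n, s'.arr 6 a ≠ 0) := by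
  refine Runs.seq (Runs.fill (B := 0) (fun _ => 0) hn ?_ ?_ ?_) ?_
  · intro s' ha
    exact (henv.agree ha).var_n
  · exact fun _ _ => rfl
  · exact fun _ _ _ _ _ _ => rfl
  rintro s₁ ha₁ ⟨hin, -⟩
  have henv₁ := henv.agree ha₁
  have hys₁ := hys.agree ha₁
  rw [← ha₁.var 6 rfl] at h6
  rw [← ha₁.var 13 rfl] at h13
  clear ha₁
  have harr : ∀ a : Fin n, (s₁.setArr 6 ((Expr.const 0).eval s₁)
      ((Expr.add (.var 13) (.const 1)).eval s₁)).arr 6 a = if (a : ℕ) = 0 then c + 1 else 0 := by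
    intro a
    have := hin a a.2
    rw [zero_add] at this
    simp [State.setArr_arr, Expr.eval, h13, this]
  refine Runs.seq (Q := fun s' => HoldsPartial x ys[k] c s' ∧
    (⟨0, by omega⟩ : Fin n) ∈ support n s') (Runs.store ⟨⟨fun a => ?_, fun σ _ h0 a => ?_⟩, ?_⟩) ?_
  · rw [harr]
    split_ifs <;> omega
  · rw [harr]
    split_ifs with h
    · intro _
      rw [h0 a h]
    · simp
  · rw [mem_support, harr]
    simp
  rintro s₂ ha₂ ⟨hS, h0⟩
  have henv₂ := henv₁.agree ha₂
  have hys₂ := hys₁.agree ha₂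
  rw [← ha₂.var 6 rfl] at h6
  clear ha₂
  refine (Runs.forLoop (N := n) (fun r s' => HoldsPartial x ys[k] c s' ∧
    (support n s').Nonempty ∧ (support n s' = Finset.univ ∨ r < (support n s').card)) rfl hn
    ?_ (fun _ _ _ h => ⟨⟨h.1.le, h.1.eq⟩, h.2⟩)
    ⟨hS, ⟨_, h0⟩, Or.inr (Finset.card_pos.2 ⟨_, h0⟩)⟩ ?_).mono ?_
  · intro s' ha
    exact (henv₂.agree ha).var_n
  · rintro r s' hr - ha ⟨hS', hne, hcard⟩
    refine (propagate_runs hn ht (henv₂.agree ha) (hys₂.agree ha) hk (by rw [ha.var 6 rfl, h6])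
      hS').mono ?_
    rintro s'' - ⟨hS'', hsub, hm⟩
    refine ⟨hS'', hne.mono hsub, ?_⟩
    rcases hcard with h | h
    · exact Or.inl (Finset.univ_subset_iff.1 (h ▸ hsub))
    · by_cases heq : support n s' = support n s''
      · rw [← heq] at hm
        exact Or.inl (heq ▸ hx _ hne hm)
      · have := Finset.card_lt_card (hsub.ssubset_of_ne heq)
        exact Or.inr (by omega)
  · rintro s' - ⟨hS', -, h⟩
    have hcard := Finset.card_le_univ (support n s')
    rw [Fintype.card_fin] at hcard
    rcases h with h | h
    · exact ⟨hS', fun a => mem_support.1 (h ▸ Finset.mem_univ a)⟩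
    · omega

/-- Test whether the function in array `6` is injective and conjugates `x` to the tuple with index
`var 6`; variable `16` becomes nonzero if it is not. -/
def test : Prog :=
  .seq (.assign 16 (.const 0))
    (.seq (forLoop 14 (.var 0) (forLoop 8 (.var 1) (.assign 16 (.add (.var 16)
        (Expr.dist (.sub (.read 6 (.read 0 (.add (.read 3 (.var 8)) (.var 14)))) (.const 1))
          imageExpr)))))
      (forLoop 14 (.var 0) (forLoop 18 (.var 14) (.assign 16 (.add (.var 16) (.sub (.const 1)
        (Expr.dist (.sub (.read 6 (.var 14)) (.const 1))
          (.sub (.read 6 (.var 18)) (.const 1)))))))))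

theorem test_runs {s : State} (hn : n ≤ X) (ht : t ≤ X) (henv : Env x s) (hys : HoldsTuples s ys)
    (hk : k < ys.length) (h6 : s.var 6 = k) (f : Fin n → Fin n)
    (hf : ∀ a : Fin n, s.arr 6 a - 1 = f a) :
    Runs X test s (fun s' => s'.var 16 = 0 ↔
      (∀ i a, f (x i a) = ys[k] i (f a)) ∧ Function.Injective f) := by
  refine Runs.seq (Q := fun s' => s'.var 16 = 0) (Runs.assign rfl) fun s₁ ha₁ h16 => ?_
  have henv₁ := henv.agree ha₁
  have hys₁ := hys.agree ha₁
  rw [← ha₁.var 6 rfl] at h6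
  rw [← ha₁.arr 6 rfl] at hf
  clear ha₁
  refine Runs.seq (Runs.check (w := 16) (N := n)
    (fun a => ∀ h : a < n, ∀ i : ℕ, i < t → ∀ hi : i < t,
      f (x ⟨i, hi⟩ ⟨a, h⟩) = ys[k] ⟨i, hi⟩ (f ⟨a, h⟩)) rfl (by decide) hn ?_ ?_) ?_
  · intro s' ha
    exact (henv₁.agree ha).var_n
  · intro a s' ha h14 hag
    have henv' := henv₁.agree hag
    have hys' := hys₁.agree hag
    rw [← hag.var 6 rfl] at h6
    rw [← hag.arr 6 rfl] at hf
    rw [forall_prop_of_true ha]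
    refine Runs.check (w := 16) (N := t) _ rfl (by decide) ht ?_ ?_
    · intro s'' hag'
      exact (henv'.agree hag').var_t
    · intro i s'' hi h8 hag'
      have henv'' := henv'.agree hag'
      rw [← hag'.var 6 rfl] at h6
      rw [← hag'.var 14 rfl] at h14
      rw [← hag'.arr 6 rfl] at hf
      refine Runs.assign ?_
      rw [accumulate_eq_zero, Expr.dist_eval_eq_zero,
        imageExpr_eval (i := ⟨i, hi⟩) henv'' (hys'.agree hag') hk h6 h8 h14 (f ⟨a, ha⟩)
          (hf ⟨a, ha⟩), forall_prop_of_true hi, Fin.ext_iff, ← hf]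
      have hg : s''.arr 0 (i * n + a) = x ⟨i, hi⟩ ⟨a, ha⟩ := henv''.gens ⟨i, hi⟩ ⟨a, ha⟩
      simp only [Expr.eval, h8, h14, henv''.rows i hi, hg]
  intro s₂ ha₂ h₂
  have henv₂ := henv₁.agree ha₂
  rw [← ha₂.arr 6 rfl] at hf
  clear ha₂
  refine (Runs.check (w := 16) (N := n)
    (fun a => ∀ h : a < n, ∀ a' : ℕ, a' < a → ∀ h' : a' < n, f ⟨a, h⟩ ≠ f ⟨a', h'⟩)
    rfl (by decide) hn ?_ ?_).mono ?_
  · intro s' ha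
    exact (henv₂.agree ha).var_n
  · intro a s' ha h14 hag
    rw [← hag.arr 6 rfl] at hf
    rw [forall_prop_of_true ha]
    refine Runs.check (w := 16) (N := a) _ rfl (by decide) (by omega) ?_ ?_
    · intro s'' hag'
      simp only [Expr.eval]
      rw [hag'.var 14 rfl, h14]
    · intro a' s'' ha' h18 hag'
      rw [← hag'.var 14 rfl] at h14
      rw [← hag'.arr 6 rfl] at hf
      have ha'' : a' < n := by omega
      refine Runs.assign ?_
      rw [accumulate_eq_zero, forall_prop_of_true ha'', ne_eq, Fin.ext_iff, ← hf, ← hf]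
      refine and_congr_right fun _ => ?_
      simp only [Expr.dist, Expr.eval, h14, h18]
      omega
  · intro s' _ h
    rw [h, h₂, and_iff_right h16]
    refine and_congr ⟨fun h i a => h a a.2 a.2 i i.2 i.2, fun h a _ ha i _ hi => h _ _⟩
      ⟨fun h a a' e => ?_, fun h a _ ha a' haa' ha' e => ?_⟩
    · rcases lt_trichotomy (a : ℕ) a' with h' | h' | h'
      · exact absurd e.symm (h a' a'.2 a'.2 a h' a.2)
      · exact Fin.ext h'
      · exact absurd e (h a a.2 a.2 a' h' a'.2)
    · have := Fin.ext_iff.1 (h e)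
      simp only at this
      omega

/-- The output area holds the list `zs` of permutations; variable `17` is the address behind the
last one. -/
structure HoldsPerms (s : State) (zs : List (Equiv.Perm (Fin n))) : Prop where
  length : s.var 3 = zs.length
  next : s.var 17 = zs.length * n
  entry : ∀ (p : ℕ) (hp : p < zs.length) (a : Fin n), s.arr 2 (p * n + a) = zs[p] a

theorem HoldsPerms.agree {P : Prog} {s s' : State} {zs : List (Equiv.Perm (Fin n))}
    (h : HoldsPerms s zs) (ha : Agree P s s')
    (hP : (P.writesVar 3 || P.writesVar 17 || P.writesArr 2) = false := by rfl) :
    HoldsPerms s' zs := by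
  simp only [Bool.or_eq_false_iff] at hP
  obtain ⟨⟨h3, h17⟩, g2⟩ := hP
  refine ⟨?_, ?_, ?_⟩
  · rw [ha.var 3 h3, h.length]
  · rw [ha.var 17 h17, h.next]
  · rw [ha.arr 2 g2]; exact h.entry

/-- Append the permutation in array `6` to the output. -/
def emit : Prog :=
  .seq (forLoop 14 (.var 0)
      (.store 2 (.add (.var 17) (.var 14)) (.sub (.read 6 (.var 14)) (.const 1))))
    (.seq (.assign 3 (.add (.var 3) (.const 1))) (.assign 17 (.add (.var 17) (.var 0))))

theorem emit_runs {s : State} (hn : n ≤ X) (henv : Env x s) {zs : List (Equiv.Perm (Fin n))}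
    (hzs : HoldsPerms s zs) (z : Equiv.Perm (Fin n)) (hz : ∀ a : Fin n, s.arr 6 a - 1 = z a) :
    Runs X emit s (fun s' => HoldsPerms s' (zs ++ [z])) := by
  refine Runs.seq (Runs.fill (B := zs.length * n) (fun q => s.arr 6 q - 1) hn ?_ ?_ ?_) ?_
  · intro s' ha
    exact (henv.agree ha).var_n
  · intro s' ha
    simp only [Expr.eval]
    rw [ha.var 17 rfl, hzs.next]
  · intro s' q ha _ hv _
    simp only [Expr.eval]
    rw [ha.arr 6 rfl, hv]
  rintro s₁ ha₁ ⟨hin, hout⟩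
  have hn₁ := (henv.agree ha₁).var_n
  have h3 : s₁.var 3 = zs.length := by rw [ha₁.var 3 rfl, hzs.length]
  have h17 : s₁.var 17 = zs.length * n := by rw [ha₁.var 17 rfl, hzs.next]
  refine Runs.seq (Q := fun s' => s' = s₁.setVar 3 (zs.length + 1)) (Runs.assign ?_) ?_
  · simp only [Expr.eval, h3]
  rintro s₂ - rfl
  refine Runs.assign ⟨?_, ?_, ?_⟩
  · simp [State.setVar_var, Expr.eval]
  · simp [State.setVar_var, Expr.eval, hn₁, h17, Nat.add_mul]
  · intro p hp a
    rw [State.setVar_arr, State.setVar_arr, List.getElem_append]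
    split_ifs with h
    · rw [hout _ (Or.inl (mul_add_lt_mul h a.2)), hzs.entry]
    · simp only [List.length_append, List.length_singleton] at hp
      obtain rfl : p = zs.length := by omega
      rw [hin a a.2, hz]
      simp

/-- Construct the permutation that conjugates `x` to the tuple with index `var 6` and maps `0` to
`var 13`, if it exists, and append it to the output. -/
def process : Prog := .seq build (.seq test (.cond (.var 16) .skip emit))

/-- Whatever passes the test is a permutation that conjugates `x` to the given tuple, regardless of
how it was built; conversely, a permutation with these properties is what `build` finds. -/
theorem process_runs {s : State} (hn : n ≤ X) (ht : t ≤ X) (hx : OnlyFullClosed x) (henv : Env x s)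
    (hys : HoldsTuples s ys) (hk : k < ys.length) (h6 : s.var 6 = k) (h13 : s.var 13 = c)
    (hc : c < n) {zs : List (Equiv.Perm (Fin n))} (hzs : HoldsPerms s zs) :
    Runs X process s (fun s' => ∃ zs', zs ⊆ zs' ∧ HoldsPerms s' zs' ∧
      (∀ z ∈ zs', z ∈ zs ∨ Conjugates x ys[k] z) ∧
      ∀ σ, Conjugates x ys[k] σ → (∀ a : Fin n, (a : ℕ) = 0 → (σ a : ℕ) = c) → σ ∈ zs') := by
  refine Runs.seq (build_runs hn ht hx henv hys hk h6 h13 hc) fun s₁ ha₁ ⟨hS, hne⟩ => ?_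
  have henv₁ := henv.agree ha₁
  rw [← ha₁.var 6 rfl] at h6
  have hlt : ∀ a : Fin n, s₁.arr 6 a - 1 < n := fun a => by
    have := hS.le a
    omega
  set f : Fin n → Fin n := fun a => ⟨s₁.arr 6 a - 1, hlt a⟩ with hf
  have hfσ : ∀ σ, Conjugates x ys[k] σ → (∀ a : Fin n, (a : ℕ) = 0 → (σ a : ℕ) = c) →
      f = σ := fun σ h h0 => by
    ext a
    simp [hf, hS.eq σ h h0 a (hne a)]
  refine Runs.seq (test_runs hn ht henv₁ (hys.agree ha₁) hk h6 f fun _ => rfl) fun s₂ ha₂ h₂ => ?_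
  have hzs₂ := (hzs.agree ha₁).agree ha₂
  refine Runs.cond (fun hb => Runs.skip ⟨zs, List.Subset.refl _, hzs₂, fun z hz => Or.inl hz,
    fun σ h h0 => ?_⟩) fun hb => ?_
  · refine absurd (h₂.2 ⟨fun i a => ?_, ?_⟩) hb
    · rw [hfσ σ h h0]
      exact h i a
    · rw [hfσ σ h h0]
      exact σ.injective
  · obtain ⟨hconj, hinj⟩ := h₂.1 hb
    refine (emit_runs hn (henv₁.agree ha₂) hzs₂
      (Equiv.ofBijective f (Finite.injective_iff_bijective.1 hinj)) fun a => ?_).mono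
      fun s₃ _ h₃ => ⟨_, List.subset_append_left _ _, h₃, fun z hz => ?_, fun σ h h0 => ?_⟩
    · rw [ha₂.arr 6 rfl]
      rfl
    · rcases List.mem_append.1 hz with hz | hz
      · exact Or.inl hz
      · rw [List.mem_singleton.1 hz]
        exact Or.inr hconj
    · refine List.mem_append_right _ (List.mem_singleton.2 (Equiv.ext fun a => ?_))
      exact (congrFun (hfσ σ h h0) a).symm

/-- Output all permutations that conjugate `x` to a tuple of the list. -/
def enumerate : Prog := forLoop 6 (.var 5) (forLoop 13 (.var 0) process)

theorem enumerate_runs {s : State} (hn0 : 0 < n) (hn : n ≤ X) (ht : t ≤ X) (hX : ys.length ≤ X)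
    (hx : OnlyFullClosed x) (henv : Env x s) (hys : HoldsTuples s ys)
    (hzs : HoldsPerms s ([] : List (Equiv.Perm (Fin n)))) :
    Runs X enumerate s (fun s' => ∃ zs : List (Equiv.Perm (Fin n)), HoldsPerms s' zs ∧
      ∀ z, z ∈ zs ↔ ∃ y ∈ ys, Conjugates x y z) := by
  refine (Runs.forLoop (N := ys.length) (fun k s' => ∃ zs : List (Equiv.Perm (Fin n)),
    HoldsPerms s' zs ∧ (∀ z ∈ zs, ∃ y ∈ ys, Conjugates x y z) ∧
    ∀ p (hp : p < ys.length), p < k → ∀ σ, Conjugates x ys[p] σ → σ ∈ zs) rfl hX ?_ ?_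
    ⟨[], hzs, by simp, by simp⟩ ?_).mono ?_
  · intro s' ha
    exact (hys.agree ha).length
  · rintro k s' w ⟨zs, h, h'⟩
    exact ⟨zs, ⟨h.length, h.next, h.entry⟩, h'⟩
  · rintro k s₁ hk h6 ha₁ ⟨zs₁, hzs₁, hs₁, hc₁⟩
    have henv₁ := henv.agree ha₁
    have hys₁ := hys.agree ha₁
    clear ha₁
    refine (Runs.forLoop (N := n) (fun c s' => ∃ zs : List (Equiv.Perm (Fin n)), zs₁ ⊆ zs ∧
      HoldsPerms s' zs ∧ (∀ z ∈ zs, ∃ y ∈ ys, Conjugates x y z) ∧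
      ∀ σ, Conjugates x ys[k] σ → (σ ⟨0, hn0⟩ : ℕ) < c → σ ∈ zs) rfl hn ?_ ?_
      ⟨zs₁, List.Subset.refl _, hzs₁, hs₁, by simp⟩ ?_).mono ?_
    · intro s' ha
      exact (henv₁.agree ha).var_n
    · rintro c s' w ⟨zs, hsub, h, h'⟩
      exact ⟨zs, hsub, ⟨h.length, h.next, h.entry⟩, h'⟩
    · rintro c s₂ hc h13 ha₂ ⟨zs₂, hsub₂, hzs₂, hs₂, hc₂⟩
      refine (process_runs hn ht hx (henv₁.agree ha₂) (hys₁.agree ha₂) hk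
        (by rw [ha₂.var 6 rfl, h6]) h13 hc hzs₂).mono ?_
      rintro s₃ - ⟨zs₃, hsub₃, hzs₃, hs₃, hc₃⟩
      refine ⟨zs₃, fun z hz => hsub₃ (hsub₂ hz), hzs₃, fun z hz => ?_, fun σ h hσ => ?_⟩
      · rcases hs₃ z hz with h | h
        · exact hs₂ z h
        · exact ⟨_, List.getElem_mem hk, h⟩
      · rcases Nat.lt_succ_iff_lt_or_eq.1 hσ with h' | h'
        · exact hsub₃ (hc₂ σ h h')
        · refine hc₃ σ h fun a ha => ?_
          rw [show a = ⟨0, hn0⟩ from Fin.ext ha, h']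
    · rintro s₂ - ⟨zs₂, hsub₂, hzs₂, hs₂, hc₂⟩
      refine ⟨zs₂, hzs₂, hs₂, fun p hp hpk σ h => ?_⟩
      rcases Nat.lt_succ_iff_lt_or_eq.1 hpk with h' | rfl
      · exact hsub₂ (hc₁ p hp h' σ h)
      · exact hc₂ σ h (Fin.is_lt _)
  · rintro s' - ⟨zs, hzs', hs, hc⟩
    refine ⟨zs, hzs', fun z => ⟨hs z, ?_⟩⟩
    rintro ⟨y, hy, h⟩
    obtain ⟨p, hp, rfl⟩ := List.getElem_of_mem hy
    exact hc p hp hp z h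

end RAM

namespace RAM

/-! ### The tuples of group elements and the normaliser -/

variable {X : ℕ} {n t : ℕ} {x : Fin t → Equiv.Perm (Fin n)} {G : Subgroup (Equiv.Perm (Fin n))}

/-- In a finite group, inverses are not needed for generating a subgroup. -/
theorem mem_submonoid_of_closure {H ι : Type*} [Group H] [Finite H] {x : ι → H} {G : Subgroup H}
    (hG : Subgroup.closure (Set.range x) = G) (M : Submonoid H) (hM : ∀ i, x i ∈ M) {g : H}
    (hg : g ∈ G) : g ∈ M := by
  rw [← hG, ← Subgroup.mem_toSubmonoid, Subgroup.closure_toSubmonoid_of_finite] at hg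
  exact (Submonoid.closure_le.2 (by rintro _ ⟨i, rfl⟩; exact hM i)) hg

theorem onlyFullClosed (htrans : MulAction.IsPretransitive G (Fin n))
    (hG : Subgroup.closure (Set.range x) = G) : OnlyFullClosed x := by
  rintro D ⟨a, ha⟩ hD
  refine Finset.eq_univ_of_forall fun b => ?_
  obtain ⟨⟨g, hg⟩, rfl⟩ := htrans.exists_smul_eq a b
  let M : Submonoid (Equiv.Perm (Fin n)) :=
    { carrier := {g | ∀ a ∈ D, g a ∈ D}
      one_mem' := fun a ha => ha
      mul_mem' := fun hg hh a ha => hg _ (hh a ha) }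
  exact mem_submonoid_of_closure hG M (fun i a ha => hD a ha i) hg a ha

/-- A set of tuples which contains the tuple of identities and is closed under the moves contains
all tuples of elements of `G`: each entry can be changed to any element of `G`, one entry after the
other. -/
theorem mem_of_closed_under_moves (hG : Subgroup.closure (Set.range x) = G)
    {S : Set (Fin t → Equiv.Perm (Fin n))} (h1 : 1 ∈ S)
    (hS : ∀ y ∈ S, ∀ j i, move x j i y ∈ S) {y : Fin t → Equiv.Perm (Fin n)} (hy : ∀ j, y j ∈ G) :
    y ∈ S := by
  have hmul : ∀ (j : Fin t), ∀ g ∈ G, ∀ y ∈ S, Function.update y j (g * y j) ∈ S := by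
    intro j g hg
    let M : Submonoid (Equiv.Perm (Fin n)) :=
      { carrier := {g | ∀ y ∈ S, Function.update y j (g * y j) ∈ S}
        one_mem' := fun y hy => by simpa using hy
        mul_mem' := fun {g h} hg hh y hy => by
          simpa [mul_assoc] using hg _ (hh y hy) }
    exact mem_submonoid_of_closure hG M (fun i y hy => hS y hy j i) hg
  have key : ∀ F : Finset (Fin t), (fun j => if j ∈ F then y j else 1) ∈ S := by
    intro F
    induction F using Finset.induction_on with
    | empty => exact h1
    | insert j F hj ih =>
      convert hmul j (y j) (hy j) _ ih using 1
      ext1 j'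
      by_cases h : j' = j
      · subst h
        simp [hj]
      · simp [h]
  simpa using key Finset.univ

/-- A permutation normalises `G` if and only if it conjugates the generators to elements of `G`. -/
theorem exists_conjugates_iff (hG : Subgroup.closure (Set.range x) = G)
    (σ : Equiv.Perm (Fin n)) :
    (∃ y : Fin t → Equiv.Perm (Fin n), (∀ j, y j ∈ G) ∧ Conjugates x y σ) ↔
      σ ∈ Subgroup.normalizer (G : Set (Equiv.Perm (Fin n))) := by
  constructor
  · rintro ⟨y, hy, hσ⟩
    refine Subgroup.mem_normalizer_fintype fun g hg => ?_
    refine mem_submonoid_of_closure hG (G.comap (MulAut.conj σ).toMonoidHom).toSubmonoid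
      (fun i => ?_) hg
    have : σ * x i * σ⁻¹ = y i := by
      ext a
      simp [hσ i]
    simpa [this] using hy i
  · intro hσ
    refine ⟨fun j => σ * x j * σ⁻¹, fun j => (hσ _).1 ?_, fun i a => by simp⟩
    rw [← hG]
    exact Subgroup.subset_closure ⟨j, rfl⟩

/-- A permutation in `G` is determined by the images of the points of a base. -/
theorem card_le_of_isBase {b : ℕ} {β : Fin b → Fin n} (hβ : IsBase G β) :
    Nat.card G ≤ n ^ b := by
  have hinj : Function.Injective fun (g : G) (j : Fin b) => (g : Equiv.Perm (Fin n)) (β j) := by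
    intro g h hgh
    have := hβ (h⁻¹ * g) (G.mul_mem (G.inv_mem h.2) g.2) fun j => by
      have := congrFun hgh j
      simp only at this
      simp [this]
    exact Subtype.ext (inv_mul_eq_one.1 this).symm
  simpa using Nat.card_le_card_of_injective _ hinj

theorem IsTupleList.length_le {b : ℕ} {β : Fin b → Fin n} (hβ : IsBase G β)
    {ys : List (Fin t → Equiv.Perm (Fin n))} (hys : IsTupleList G ys) :
    ys.length ≤ n ^ (b * t) := by
  let F : Fin ys.length → (Fin t → G) := fun k j => ⟨ys[k] j, hys.mem _ (List.getElem_mem _) j⟩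
  have hF : Function.Injective F := by
    intro k k' h
    refine Fin.ext ((hys.nodup.getElem_inj_iff (hi := k.2) (hj := k'.2)).1 (funext fun j => ?_))
    exact congrArg Subtype.val (congrFun h j)
  calc ys.length = Nat.card (Fin ys.length) := by simp
    _ ≤ Nat.card (Fin t → G) := Nat.card_le_card_of_injective F hF
    _ = Nat.card G ^ t := by simp [Nat.card_fun]
    _ ≤ (n ^ b) ^ t := Nat.pow_le_pow_left (card_le_of_isBase hβ) t
    _ = n ^ (b * t) := (pow_mul _ _ _).symm

/-- The program that computes the normaliser, for `1 < n`; for `n = 1` it halts at once, with the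
empty list of generators. -/
def normaliserProg : Prog :=
  .cond (.sub (.var 0) (.const 1)) (.seq setup (.seq closeList enumerate)) .skip

/-- A bound for the passes through each loop of `normaliserProg`.  For `1 < n` and `1 ≤ t * b`,
both `|G| ^ t` and `t * n` are at most `n ^ (2 * (t * b))`; for `n = 1` no loop is entered. -/
def passBound (n t b : ℕ) : ℕ := if n ≤ 1 then 0 else n ^ (2 * (t * b))

theorem normaliserProg_runs {b : ℕ} (hn : 1 ≤ n) (htrans : MulAction.IsPretransitive G (Fin n))
    (hG : Subgroup.closure (Set.range x) = G) {β : Fin b → Fin n} (hβ : IsBase G β)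
    (htb : 1 < n → 1 ≤ t * b) :
    Runs (passBound n t b) normaliserProg (initial x β) (fun s =>
      HoldsGenerators s (Subgroup.normalizer (G : Set (Equiv.Perm (Fin n))))) := by
  refine Runs.cond (fun hc => ?_) fun hc => ?_
  · replace hc : 1 < n := by
      have : n - 1 ≠ 0 := hc
      omega
    have hX : passBound n t b = n ^ (t * b) * n ^ (t * b) := by
      rw [passBound, if_neg (by omega), two_mul, pow_add]
    have htb := htb hc
    have hle : n ≤ n ^ (t * b) := Nat.le_self_pow (by omega) n
    have hte : t ≤ n ^ (t * b) :=
      (Nat.le_mul_of_pos_right t (Nat.pos_of_ne_zero fun h => by simp [h] at htb)).trans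
        (Nat.lt_pow_self hc).le
    have hpos : 1 ≤ n ^ (t * b) := Nat.one_le_pow _ _ hn
    have hnX : n ≤ passBound n t b := hX ▸ hle.trans (Nat.le_mul_of_pos_right _ hpos)
    have htX : t ≤ passBound n t b := hX ▸ hte.trans (Nat.le_mul_of_pos_right _ hpos)
    have hlX : t * n ≤ passBound n t b := hX ▸ Nat.mul_le_mul hte hle
    have hyX : ∀ ys : List (Fin t → Equiv.Perm (Fin n)), IsTupleList G ys →
        ys.length ≤ passBound n t b := fun ys hys =>
      hX ▸ ((hys.length_le hβ).trans (by rw [mul_comm])).trans (Nat.le_mul_of_pos_right _ hpos)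
    have hxG : ∀ i, x i ∈ G := fun i => hG ▸ Subgroup.subset_closure ⟨i, rfl⟩
    refine Runs.seq (setup_runs hnX htX β) fun s₁ ha₁ ⟨henv₁, hys₁⟩ => ?_
    have hzs₁ : HoldsPerms s₁ ([] : List (Equiv.Perm (Fin n))) :=
      ⟨ha₁.var 3 rfl, by rw [ha₁.var 17 rfl, List.length_nil, zero_mul]; rfl, by simp⟩
    refine Runs.seq (closeList_runs hnX htX hlX hyX hxG henv₁ hys₁
      ⟨List.nodup_singleton _, by simp [G.one_mem]⟩) ?_
    rintro s₂ ha₂ ⟨ys, hp, hys₂, hG₂, hclosed⟩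
    have hmem : ∀ y : Fin t → Equiv.Perm (Fin n), y ∈ ys ↔ ∀ j, y j ∈ G := fun y =>
      ⟨hG₂.mem y, mem_of_closed_under_moves (S := {y | y ∈ ys}) hG (hp.subset (by simp)) hclosed⟩
    refine (enumerate_runs (by omega) hnX htX (hyX ys hG₂) (onlyFullClosed htrans hG)
      (henv₁.agree ha₂) hys₂ (hzs₁.agree ha₂)).mono ?_
    rintro s₃ - ⟨zs, hzs, hz⟩
    have hlt : ∀ i : Fin (s₃.var 3), (i : ℕ) < zs.length := fun i => hzs.length ▸ i.2
    have hrange : Set.range (fun i : Fin (s₃.var 3) => zs[(i : ℕ)]'(hlt i)) =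
        (Subgroup.normalizer (G : Set (Equiv.Perm (Fin n))) : Set (Equiv.Perm (Fin n))) := by
      ext σ
      rw [SetLike.mem_coe, ← exists_conjugates_iff hG]
      simp only [← hmem]
      rw [← hz σ]
      constructor
      · rintro ⟨i, rfl⟩
        exact List.getElem_mem _
      · intro h
        obtain ⟨p, hp, rfl⟩ := List.getElem_of_mem h
        exact ⟨⟨p, hzs.length ▸ hp⟩, rfl⟩
    refine ⟨fun i => zs[(i : ℕ)]'(hlt i), fun i a => hzs.entry i (hlt i) a, ?_⟩
    rw [hrange, Subgroup.closure_eq]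
  · -- For `n = 1` the empty list generates the symmetric group.
    replace hc : n = 1 := by
      have : n - 1 = 0 := hc
      omega
    subst hc
    exact Runs.skip ⟨fun _ => 1, fun i => i.elim0, Subsingleton.elim _ _⟩

/-- The trivial group is not transitive on two or more points, so there are generators and base
points. -/
theorem one_le_mul_of_transitive {b : ℕ} (hn : 1 < n)
    (htrans : MulAction.IsPretransitive G (Fin n)) (hG : Subgroup.closure (Set.range x) = G)
    {β : Fin b → Fin n} (hβ : IsBase G β) : 1 ≤ t * b := by
  have hG1 : G ≠ ⊥ := by
    rintro rfl
    obtain ⟨⟨g, hg⟩, h⟩ := htrans.exists_smul_eq ⟨0, by omega⟩ ⟨1, hn⟩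
    rw [Subgroup.mem_bot] at hg
    subst hg
    simpa [Fin.ext_iff] using congrArg Fin.val h
  refine Nat.one_le_iff_ne_zero.2 fun h => hG1 ?_
  rcases Nat.mul_eq_zero.1 h with rfl | rfl
  · rw [← hG, Set.range_eq_empty, Subgroup.closure_empty]
  · exact (Subgroup.eq_bot_iff_forall G).2 fun g hg => hβ g hg fun j => j.elim0

theorem passBound_add_two_le {b : ℕ} (htb : 1 < n → 1 ≤ t * b) :
    ((passBound n t b + 2 : ℕ) : ℝ) ≤
      2 ^ (4 * max 1 ((t : ℝ) * (b : ℝ) * Real.logb 2 (n : ℝ))) := by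
  set m := max 1 ((t : ℝ) * (b : ℝ) * Real.logb 2 (n : ℝ)) with hm
  by_cases hn : n ≤ 1
  · rw [passBound, if_pos hn]
    calc ((0 + 2 : ℕ) : ℝ) = 2 ^ (1 : ℝ) := by norm_num
      _ ≤ 2 ^ (4 * m) := Real.rpow_le_rpow_of_exponent_le (by norm_num)
        (by linarith [le_max_left 1 ((t : ℝ) * (b : ℝ) * Real.logb 2 (n : ℝ))])
  · push Not at hn
    have htb := htb hn
    have hnat : passBound n t b + 2 ≤ n ^ (4 * (t * b)) := by
      rw [passBound, if_neg (by omega), show 4 * (t * b) = 2 * (t * b) + 2 * (t * b) by ring,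
        pow_add]
      have : 2 ^ 2 ≤ n ^ (2 * (t * b)) :=
        (Nat.pow_le_pow_left hn 2).trans (Nat.pow_le_pow_right (by omega) (by omega))
      nlinarith
    have hn0 : (0 : ℝ) < n := by positivity
    calc ((passBound n t b + 2 : ℕ) : ℝ) ≤ ((n ^ (4 * (t * b)) : ℕ) : ℝ) := by exact_mod_cast hnat
      _ = (2 ^ Real.logb 2 n) ^ (4 * (t * b)) := by
        rw [Real.rpow_logb (by norm_num) (by norm_num) hn0, Nat.cast_pow]
      _ = 2 ^ (4 * ((t : ℝ) * b * Real.logb 2 n)) := by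
        rw [← Real.rpow_natCast, ← Real.rpow_mul (by norm_num)]
        push_cast
        ring_nf
      _ ≤ 2 ^ (4 * m) := Real.rpow_le_rpow_of_exponent_le (by norm_num)
        (by linarith [le_max_right 1 ((t : ℝ) * (b : ℝ) * Real.logb 2 (n : ℝ))])

end RAM

theorem theorem3p3 :
    ∃ (P : RAM.Prog) (C : ℝ),
      ∀ (n t b : ℕ), 1 ≤ n →
      ∀ (G : Subgroup (Equiv.Perm (Fin n))), MulAction.IsPretransitive G (Fin n) →
      ∀ (x : Fin t → Equiv.Perm (Fin n)), Subgroup.closure (Set.range x) = G →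
      ∀ (β : Fin b → Fin n), IsBase G β →
      ∃ (s : RAM.State) (k : ℕ),
        RAM.Exec P (RAM.initial x β) s k ∧
        RAM.HoldsGenerators s (Subgroup.normalizer (G : Set (Equiv.Perm (Fin n)))) ∧
        (k : ℝ) ≤ 2 ^ (C * max 1 ((t : ℝ) * (b : ℝ) * Real.logb 2 (n : ℝ))) := by
  refine ⟨RAM.normaliserProg, 4 * RAM.normaliserProg.exponent, ?_⟩
  intro n t b hn G htrans x hG β hβ
  have htb := fun h => RAM.one_le_mul_of_transitive h htrans hG hβ
  obtain ⟨s, k, he, hk, hs⟩ := RAM.normaliserProg_runs hn htrans hG hβ htb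
  refine ⟨s, k, he, hs, ?_⟩
  -- The exponent is a numeral in disguise, which must not be evaluated.
  generalize RAM.normaliserProg.exponent = p at *
  calc (k : ℝ) ≤ ((RAM.passBound n t b + 2 : ℕ) : ℝ) ^ p := by
        exact_mod_cast hk
    _ ≤ (2 ^ (4 * max 1 ((t : ℝ) * (b : ℝ) * Real.logb 2 (n : ℝ)))) ^ p :=
        pow_le_pow_left₀ (by positivity) (RAM.passBound_add_two_le htb) _
    _ = _ := by
        rw [← Real.rpow_natCast, ← Real.rpow_mul (by norm_num)]
        ring_nf
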